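/- Let $(X,\Sigma,\mu)$ be a probability space and $T:X\to X$ an invertible (bimeasurable) measure-preserving transformation. A spectral measure of $T$ is a Borel probability measure $\sigma$ on the unit circle $S^1$ for which there is $B\in\Sigma$ with $0<\mu(B)<1$ and $$\int z^{\ell}\,d\sigma(z)=\frac{\mu(T^{\ell}(B)\cap B)-\mu(B)^2}{\mu(B)(1-\mu(B))}\qquad\text{for all }\ell\in\mathbb{Z}.$$ $T$ is weakly power ergodic when, for every spectral measure $\sigma$ of $T$, $$\lim_{N\to\infty}\ \sup_{1\le k\le N}\int\Big|\frac1N\sum_{n=1}^{N}z^{nk}\Big|^2d\sigma(z)=0.$$ For a sequence $(a_n)_{n\ge1}$ of positive integers put $a_n^{(k)}=a_n+a_{n+1}+\cdots+a_{n+k-1}$. The sequence is universally weakly power ergodic when, for every weakly power ergodic invertible measure-preserving transformation $T$ of a probability space and every spectral measure $\sigma$ of $T$, $$\lim_{N\to\infty}\ \sup_{1\le k\le N}\int\Big|\frac1N\sum_{n=1}^{N}z^{a_n^{(k)}}\Big|^2d\sigma(z)=0.$$ Theorem. Let $b$ be a positive-integer-valued random variable with finite mean, let $b_1,b_2,\dots$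 be independent copies of $b$ on a probability space $(\Omega,P)$, and let $a_n(\omega)=b_1(\omega)+\cdots+b_n(\omega)$. Then for $P$-almost every $\omega$ the sequence $(a_n(\omega))_{n\ge 1}$ is universally weakly power ergodic. (The exceptional null set of $\omega$ does not depend on $T$ or on $\sigma$.) -/

import Mathlib

open MeasureTheory ProbabilityTheory Filter Topology

universe u v w

noncomputable section

/-- The unit circle carries its Borel σ-algebra. -/
instance instMeasurableSpaceCircle : MeasurableSpace Circle := borel Circle

instance instBorelSpaceCircle : BorelSpace Circle := ⟨rfl⟩

/-- The mean square `∫ |(1/N) ∑_{n=1}^{N} z^{e(n)}|² dσ(z)` of the exponential averages along the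
integer exponents `e(1), e(2), …`. -/
def meanSquare (σ : Measure Circle) (e : ℕ → ℕ) (N : ℕ) : ℝ :=
  ∫ z : Circle, ‖(1 / (N : ℂ)) * ∑ n ∈ Finset.Icc 1 N, (z : ℂ) ^ (e n)‖ ^ 2 ∂σ

/-- The image `T^ℓ(B)` of a set under an integer power of an invertible transformation. -/
def powImage {X : Type*} [MeasurableSpace X] (T : X ≃ᵐ X) (l : ℤ) (B : Set X) : Set X :=
  ((T.toEquiv : Equiv.Perm X) ^ l) '' B

/-- `σ` is the spectral measure `σ_{T,B}`: the probability measure on the unit circle whose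
`ℓ`-th Fourier coefficient is `(μ(T^ℓ(B) ∩ B) - μ(B)²) / (μ(B)(1 - μ(B)))` for all integers `ℓ`.
(The right-hand side is even in `ℓ`, so the sign convention for coefficients is immaterial.) -/
structure IsSpectralMeasureOf {X : Type*} [MeasurableSpace X] (μ : Measure X) (T : X ≃ᵐ X)
    (B : Set X) (σ : Measure Circle) : Prop where
  isProbabilityMeasure : IsProbabilityMeasure σ
  fourierCoeff_eq : ∀ l : ℤ, ∫ z : Circle, (z : ℂ) ^ l ∂σ =
    (((μ.real (powImage T l B ∩ B) - μ.real B * μ.real B)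
      / (μ.real B * (1 - μ.real B)) : ℝ) : ℂ)

/-- `σ` is a spectral measure arising from `T`: it is `σ_{T,B}` for some measurable set `B` with
`0 < μ(B) < 1`. -/
def IsSpectralMeasure {X : Type*} [MeasurableSpace X] (μ : Measure X) (T : X ≃ᵐ X)
    (σ : Measure Circle) : Prop :=
  ∃ B : Set X, MeasurableSet B ∧ 0 < μ B ∧ μ B < 1 ∧ IsSpectralMeasureOf μ T B σ

/-- Weak power ergodicity of a transformation `T`. -/
def WeaklyPowerErgodic {X : Type*} [MeasurableSpace X] (μ : Measure X) (T : X ≃ᵐ X) : Prop :=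
  ∀ σ : Measure Circle, IsSpectralMeasure μ T σ →
    Tendsto (fun N : ℕ => ⨆ k : Set.Icc 1 N, meanSquare σ (fun n => n * (k : ℕ)) N) atTop (𝓝 0)

/-- The `k`-th partial sums `a_n^{(k)} = a_n + a_{n+1} + ⋯ + a_{n+k-1}` of a sequence. -/
def partialSums (a : ℕ → ℕ) (k n : ℕ) : ℕ :=
  ∑ j ∈ Finset.range k, a (n + j)

/-- Weak power ergodicity of a sequence `a_1, a_2, …` with respect to a transformation `T`. -/
def SeqWeaklyPowerErgodic {X : Type*} [MeasurableSpace X] (a : ℕ → ℕ) (μ : Measure X)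
    (T : X ≃ᵐ X) : Prop :=
  ∀ σ : Measure Circle, IsSpectralMeasure μ T σ →
    Tendsto (fun N : ℕ => ⨆ k : Set.Icc 1 N, meanSquare σ (partialSums a (k : ℕ)) N) atTop (𝓝 0)

/-- A sequence is universally weakly power ergodic when it is weakly power ergodic with respect to
every weakly power ergodic invertible measure-preserving transformation of a probability space. -/
def UniversallyWeaklyPowerErgodic (a : ℕ → ℕ) : Prop :=
  ∀ (X : Type u) [MeasurableSpace X] (μ : Measure X) [IsProbabilityMeasure μ] (T : X ≃ᵐ X),
    MeasurePreserving T μ μ → WeaklyPowerErgodic μ T → SeqWeaklyPowerErgodic a μ T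

/-- `b 0, b 1, b 2, …` are (mutually) independent copies, on `(Ω, P)`, of the integer-valued random
variable `β` on `(Ω₀, P₀)`. -/
structure IsIIDCopies {Ω₀ Ω : Type*} [MeasurableSpace Ω₀] [MeasurableSpace Ω] (P₀ : Measure Ω₀)
    (P : Measure Ω) (β : Ω₀ → ℕ) (b : ℕ → Ω → ℕ) : Prop where
  measurable : ∀ i, Measurable (b i)
  identDistrib : ∀ i, IdentDistrib (b i) β P P₀
  iIndepFun : iIndepFun b P

/-- The stochastic sequence generated by `b 0, b 1, …`: its `n`-th term is the sum of the first
`n` of these variables. -/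
def stochasticSequence {Ω : Type*} (b : ℕ → Ω → ℕ) (ω : Ω) (n : ℕ) : ℕ :=
  ∑ i ∈ Finset.range n, b i ω

end

open scoped ComplexConjugate

/-! ### The van der Corput inequality -/

/-! Write `φ(w) = E w^b` (`powMean`). If `b` is almost surely a constant `c`, then `a_n^{(k)}` is
`n·ck` plus a term independent of `n`, and the claim is weak power ergodicity of `T` at the
multiples `ck` (`tendsto_iSup_meanSquare_mul`).

Otherwise the law of `b` has two atoms `u < v`. With `d = v - u` one gets `|φ(w)| ≤ 1 - p|w^d - 1|²`
on the circle. The only consequence of weak power ergodicity then needed is that `σ` gives no mass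
to roots of unity (`measure_setOf_pow_eq_one`), so that `{|z^d - 1| < δ}` has small mass.

Large `k` is treated uniformly by applying van der Corput twice. The difference of `a^{(k)}` at lag
`h` is a `k × h` double sum of the `b_i`. By symmetry, its difference at lag `h'` is the difference
of two `h × h'` double sums taken `k` apart (`doubleSum_shift`). The block length no longer involves
`k`, and once `k > h + h'` the two blocks are independent. The mean of `z` to such a double sum is a
product of values `φ(z^r)`, where `r` runs in part through consecutive integers. It is small because
`z^r` and `z^(r+1)` cannot both have `d`-th power near 1 when `z^d` stays away from 1. Each of the
finitely many remaining `k` needs one van der Corput step and dominated convergence.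

Empirical averages of pairs of blocks agree with their means uniformly in `k ≤ N`: martingale
differences give exponentially small failure probabilities, which beat the number of shifts in
Borel–Cantelli (`ae_eventually_sum_mul_le`). Closeness of frequencies on a suitable finite set
controls all test functions bounded by 1 at once, hence all `z`. The resulting event `IsTypical`
mentions only the law of `b`, which is why the null set is independent of `T` and `σ`. -/

theorem norm_sum_shift_sub_le {u : ℕ → ℂ} (hu : ∀ n, ‖u n‖ ≤ 1) (N h : ℕ) :
    ‖∑ n ∈ Finset.range N, u (n + h) - ∑ n ∈ Finset.range N, u n‖ ≤ 2 * h := by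
  induction h with
  | zero => simp
  | succ h ih =>
    have h1 : ∑ n ∈ Finset.range N, u (n + (h + 1)) - ∑ n ∈ Finset.range N, u n
        = (∑ n ∈ Finset.range N, u (n + h) - ∑ n ∈ Finset.range N, u n) + (u (N + h) - u h) := by
      have h2 := Finset.sum_range_succ (fun n => u (n + h)) N
      have h3 := Finset.sum_range_succ' (fun n => u (n + h)) N
      simp only [zero_add] at h3
      have h4 : ∑ n ∈ Finset.range N, u (n + (h + 1))
          = ∑ n ∈ Finset.range N, u (n + 1 + h) :=
        Finset.sum_congr rfl fun n _ => by congr 1; ring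
      rw [h4]
      linear_combination h2 - h3
    rw [h1]
    calc _ ≤ 2 * (h : ℝ) + (1 + 1) :=
          (norm_add_le _ _).trans (add_le_add ih ((norm_sub_le _ _).trans (add_le_add (hu _) (hu _))))
      _ = _ := by push_cast; ring

theorem norm_sum_range_le {u : ℕ → ℂ} (hu : ∀ n, ‖u n‖ ≤ 1) (N : ℕ) :
    ‖∑ n ∈ Finset.range N, u n‖ ≤ N := by
  simpa using norm_sum_le_of_le (Finset.range N) (fun n _ => hu n)

theorem norm_mul_conj_le {a b : ℂ} (ha : ‖a‖ ≤ 1) (hb : ‖b‖ ≤ 1) : ‖a * conj b‖ ≤ 1 := by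
  rw [norm_mul, RCLike.norm_conj]
  exact mul_le_one₀ ha (norm_nonneg _) hb

theorem norm_sum_mul_conj_shift_le {u : ℕ → ℂ} (hu : ∀ n, ‖u n‖ ≤ 1) (N h j : ℕ) :
    ‖∑ n ∈ Finset.range N, u (n + (h + j)) * conj (u (n + h))‖
      ≤ ‖∑ n ∈ Finset.range N, u (n + j) * conj (u n)‖ + 2 * h := by
  have h1 := norm_sum_shift_sub_le (u := fun n => u (n + j) * conj (u n))
    (fun n => norm_mul_conj_le (hu _) (hu _)) N h
  have h2 : ∑ n ∈ Finset.range N, u (n + (h + j)) * conj (u (n + h))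
      = ∑ n ∈ Finset.range N, u (n + h + j) * conj (u (n + h)) :=
    Finset.sum_congr rfl fun n _ => by rw [add_assoc]
  rw [h2]
  have := norm_le_norm_add_norm_sub (∑ n ∈ Finset.range N, u (n + j) * conj (u n))
    (∑ n ∈ Finset.range N, u (n + h + j) * conj (u (n + h)))
  linarith [norm_sub_rev (∑ n ∈ Finset.range N, u (n + j) * conj (u n))
    (∑ n ∈ Finset.range N, u (n + h + j) * conj (u (n + h)))]

/-- Pairs closer than `L` get the trivial bound `N`. For the others, translating by `j` reduces to
lag `i - j` and costs at most `2j` in boundary terms. -/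
theorem norm_sum_mul_conj_le_of_le {u : ℕ → ℂ} (hu : ∀ n, ‖u n‖ ≤ 1) {N H L : ℕ} {η : ℝ}
    (hη : 0 ≤ η)
    (h : ∀ j, L ≤ j → j < H → ‖∑ n ∈ Finset.range N, u (n + j) * conj (u n)‖ ≤ η * N)
    {i j : ℕ} (hi : i < H) (hij : j ≤ i) :
    ‖∑ n ∈ Finset.range N, u (n + i) * conj (u (n + j))‖
      ≤ (if i < j + L then (N : ℝ) else 0) + (η * N + 2 * H) := by
  split_ifs with hL
  · have := norm_sum_range_le (u := fun n => u (n + i) * conj (u (n + j)))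
      (fun n => norm_mul_conj_le (hu _) (hu _)) N
    have : 0 ≤ η * N + 2 * H := by positivity
    linarith
  · obtain ⟨d, rfl⟩ := Nat.exists_eq_add_of_le hij
    have h1 := norm_sum_mul_conj_shift_le hu N j d
    have h2 := h d (by omega) (by omega)
    have h3 : (j : ℝ) ≤ H := by exact_mod_cast (by omega)
    linarith

theorem norm_sum_mul_conj_comm (u : ℕ → ℂ) (N i j : ℕ) :
    ‖∑ n ∈ Finset.range N, u (n + i) * conj (u (n + j))‖
      = ‖∑ n ∈ Finset.range N, u (n + j) * conj (u (n + i))‖ := by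
  rw [← RCLike.norm_conj, map_sum]
  congr 1
  exact Finset.sum_congr rfl fun n _ => by simp [mul_comm]

/-- Averaging over windows of length `H` changes the sum only by boundary terms. Cauchy–Schwarz over
`n` then leaves the correlations of pairs of shifts, of which at most `2L` per row lack a useful
bound. -/
theorem van_der_corput {u : ℕ → ℂ} (hu : ∀ n, ‖u n‖ ≤ 1) {N H L : ℕ} (hH : 0 < H) {η : ℝ}
    (hη : 0 ≤ η)
    (h : ∀ j, L ≤ j → j < H → ‖∑ n ∈ Finset.range N, u (n + j) * conj (u n)‖ ≤ η * N) :
    ‖∑ n ∈ Finset.range N, u n‖ ^ 2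
      ≤ 2 * N * (2 * L * N / H + η * N + 2 * H) + 8 * (H : ℝ) ^ 2 := by
  set V : ℕ → ℂ := fun n => ∑ i ∈ Finset.range H, u (n + i) with hV
  have hpair : ∀ i ∈ Finset.range H, ∑ j ∈ Finset.range H,
      ‖∑ n ∈ Finset.range N, u (n + i) * conj (u (n + j))‖
        ≤ 2 * L * N + H * (η * N + 2 * H) := by
    intro i hi
    rw [Finset.mem_range] at hi
    have h1 : ∀ j ∈ Finset.range H, ‖∑ n ∈ Finset.range N, u (n + i) * conj (u (n + j))‖
        ≤ (if i < j + L ∧ j < i + L then (N : ℝ) else 0) + (η * N + 2 * H) := by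
      intro j hj
      rw [Finset.mem_range] at hj
      rcases le_total j i with hij | hij
      · refine (norm_sum_mul_conj_le_of_le hu hη h hi hij).trans ?_
        gcongr
        by_cases hL : i < j + L
        · rw [if_pos hL, if_pos ⟨hL, by omega⟩]
        · rw [if_neg hL, if_neg (by tauto)]
      · rw [norm_sum_mul_conj_comm]
        refine (norm_sum_mul_conj_le_of_le hu hη h hj hij).trans ?_
        gcongr
        by_cases hL : j < i + L
        · rw [if_pos hL, if_pos ⟨by omega, hL⟩]
        · rw [if_neg hL, if_neg (by tauto)]
    refine (Finset.sum_le_sum h1).trans ?_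
    rw [Finset.sum_add_distrib, ← Finset.sum_filter, Finset.sum_const, Finset.sum_const,
      Finset.card_range, nsmul_eq_mul, nsmul_eq_mul]
    gcongr
    -- The truncated subtraction is harmless: when `i < L` the interval starts at 0 and still
    -- reaches past `i + L`.
    have : (Finset.range H).filter (fun j => i < j + L ∧ j < i + L)
        ⊆ Finset.Ico (i - L) (i - L + 2 * L) := by
      intro j hj
      simp only [Finset.mem_filter, Finset.mem_range, Finset.mem_Ico] at hj ⊢
      omega
    have := Finset.card_le_card this
    rw [Nat.card_Ico] at this
    exact_mod_cast (by omega)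
  have hsq : ∑ n ∈ Finset.range N, ‖V n‖ ^ 2 ≤ H * (2 * L * N + H * (η * N + 2 * H)) := by
    have h1 : ((∑ n ∈ Finset.range N, ‖V n‖ ^ 2 : ℝ) : ℂ) = ∑ i ∈ Finset.range H,
        ∑ j ∈ Finset.range H, ∑ n ∈ Finset.range N, u (n + i) * conj (u (n + j)) := by
      push_cast
      simp_rw [← Complex.mul_conj', hV, map_sum, Finset.sum_mul_sum]
      rw [Finset.sum_comm]
      exact Finset.sum_congr rfl fun i _ => Finset.sum_comm
    have h2 : ∑ n ∈ Finset.range N, ‖V n‖ ^ 2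
        = ‖((∑ n ∈ Finset.range N, ‖V n‖ ^ 2 : ℝ) : ℂ)‖ := by
      rw [Complex.norm_real, Real.norm_of_nonneg (by positivity)]
    rw [h2, h1]
    refine (norm_sum_le _ _).trans ?_
    refine (Finset.sum_le_sum fun i hi => (norm_sum_le _ _).trans (hpair i hi)).trans ?_
    simp [mul_add]
  have hT : ‖∑ n ∈ Finset.range N, V n‖ ^ 2
      ≤ N * (H * (2 * L * N + H * (η * N + 2 * H))) := by
    have h1 := sq_sum_le_card_mul_sum_sq (s := Finset.range N) (f := fun n => ‖V n‖)
    rw [Finset.card_range] at h1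
    calc _ ≤ (∑ n ∈ Finset.range N, ‖V n‖) ^ 2 := by gcongr; exact norm_sum_le _ _
      _ ≤ _ := h1.trans (by gcongr)
  have hE : H * ‖∑ n ∈ Finset.range N, u n‖ ≤ ‖∑ n ∈ Finset.range N, V n‖ + 2 * (H : ℝ) ^ 2 := by
    have h1 : ∑ n ∈ Finset.range N, V n
        = ∑ i ∈ Finset.range H, ∑ n ∈ Finset.range N, u (n + i) := Finset.sum_comm
    have h2 : (H : ℂ) * ∑ n ∈ Finset.range N, u n = ∑ n ∈ Finset.range N, V n
        - ∑ i ∈ Finset.range H, (∑ n ∈ Finset.range N, u (n + i) - ∑ n ∈ Finset.range N, u n) := by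
      rw [h1, Finset.sum_sub_distrib]
      simp
    have h3 : (H : ℝ) * ‖∑ n ∈ Finset.range N, u n‖ = ‖(H : ℂ) * ∑ n ∈ Finset.range N, u n‖ := by
      simp
    rw [h3, h2]
    refine (norm_sub_le _ _).trans ?_
    gcongr
    refine (norm_sum_le_of_le (Finset.range H) (f := fun i => ∑ n ∈ Finset.range N, u (n + i)
      - ∑ n ∈ Finset.range N, u n) (n := fun _ => 2 * (H : ℝ)) fun i hi => ?_).trans ?_
    · refine (norm_sum_shift_sub_le hu N i).trans ?_
      have : (i : ℝ) ≤ H := by exact_mod_cast (Finset.mem_range.1 hi).le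
      linarith
    · simp; nlinarith
  have hH' : (0 : ℝ) < H := by exact_mod_cast hH
  have h5 : (H * ‖∑ n ∈ Finset.range N, u n‖) ^ 2
      ≤ 2 * ‖∑ n ∈ Finset.range N, V n‖ ^ 2 + 8 * (H : ℝ) ^ 4 := by
    have := pow_le_pow_left₀ (by positivity) hE 2
    nlinarith [sq_nonneg (‖∑ n ∈ Finset.range N, V n‖ - 2 * (H : ℝ) ^ 2)]
  have h6 : (H : ℝ) ^ 2 * ‖∑ n ∈ Finset.range N, u n‖ ^ 2
      ≤ (H : ℝ) ^ 2 * (2 * N * (2 * L * N / H + η * N + 2 * H) + 8 * (H : ℝ) ^ 2) := by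
    calc _ = (H * ‖∑ n ∈ Finset.range N, u n‖) ^ 2 := by ring
      _ ≤ 2 * (N * (H * (2 * L * N + H * (η * N + 2 * H)))) + 8 * (H : ℝ) ^ 4 := by linarith
      _ = _ := by field_simp; ring
  exact le_of_mul_le_mul_left h6 (by positivity)

/-- If all correlations at shifts in `[L, H)` are at most `ε`, then the averages are at most
`2 √ε` once `N` is large, where `H` depends only on `L` and `ε`. -/
theorem exists_van_der_corput {ε : ℝ} (hε : 0 < ε) (L : ℕ) :
    ∃ H : ℕ, ∀ᶠ N : ℕ in atTop, ∀ u : ℕ → ℂ, (∀ n, ‖u n‖ ≤ 1) →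
      (∀ j, L ≤ j → j < H → ‖∑ n ∈ Finset.range N, u (n + j) * conj (u n)‖ ≤ ε * N) →
      ‖∑ n ∈ Finset.range N, u n‖ ^ 2 ≤ 4 * ε * (N : ℝ) ^ 2 := by
  -- The bound `4ε` splits as `ε + 2ε + ε`: near-diagonal pairs by this choice of `H`, far pairs by
  -- hypothesis, boundary terms by taking `N ≥ 12H²/ε`.
  obtain ⟨H, hH⟩ := exists_nat_gt (4 * L / ε)
  have hHpos : (0 : ℝ) < H := lt_of_le_of_lt (by positivity) hH
  refine ⟨H, ?_⟩
  have hlarge : ∀ᶠ N : ℕ in atTop, 12 * (H : ℝ) ^ 2 / ε ≤ N :=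
    tendsto_natCast_atTop_atTop.eventually_ge_atTop _
  filter_upwards [hlarge, eventually_ge_atTop 1] with N hN hN1 u hu h
  have h1 := van_der_corput hu (by exact_mod_cast hHpos) hε.le h
  have hN1' : (1 : ℝ) ≤ N := by exact_mod_cast hN1
  have hH1 : (1 : ℝ) ≤ H := by exact_mod_cast (Nat.cast_pos.1 hHpos)
  have h2 : 2 * (L : ℝ) * N / H ≤ ε / 2 * N := by
    rw [div_lt_iff₀ hε] at hH
    rw [div_le_iff₀ hHpos]
    nlinarith
  rw [div_le_iff₀ hε] at hN
  have h3 : 4 * (N : ℝ) * H + 8 * (H : ℝ) ^ 2 ≤ ε * (N : ℝ) ^ 2 := by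
    have : (H : ℝ) ≤ H ^ 2 := by nlinarith
    have : 12 * (H : ℝ) ^ 2 * N ≤ N * ε * N := by gcongr
    have h7 : (H : ℝ) * N ≤ H ^ 2 * N := by gcongr
    have : (H : ℝ) ^ 2 ≤ H ^ 2 * N := le_mul_of_one_le_right (by positivity) hN1'
    nlinarith
  have h4 : 2 * (N : ℝ) * (2 * L * N / H) ≤ 2 * N * (ε / 2 * N) := by gcongr
  nlinarith

/-! ### Empirical averages over a countable space -/

theorem exists_finset_measureReal_gt {α : Type*} [Countable α] [MeasurableSpace α]
    [MeasurableSingletonClass α] (μ : Measure α) [IsProbabilityMeasure μ] {ε : ℝ} (hε : 0 < ε) :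
    ∃ A : Finset α, 1 - ε < ∑ a ∈ A, μ.real {a} := by
  have h1 : ∑' a, μ.real {a} = 1 := by
    have := integral_countable (μ := μ) (f := fun _ : α => (1 : ℝ)) (integrable_const _)
    simpa using this.symm
  have hs : Summable fun a => μ.real {a} := by
    by_contra h
    rw [tsum_eq_zero_of_not_summable h] at h1
    exact zero_ne_one h1
  have h2 := hs.hasSum
  rw [h1] at h2
  exact ((h2.eventually_const_lt (sub_lt_self _ hε)).exists)

theorem norm_integral_sub_finset_sum_le {α : Type*} [Countable α] [MeasurableSpace α]
    [MeasurableSingletonClass α] (μ : Measure α) [IsProbabilityMeasure μ] (A : Finset α)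
    {F : α → ℂ} (hF : ∀ a, ‖F a‖ ≤ 1) :
    ‖∫ a, F a ∂μ - ∑ a ∈ A, (μ.real {a} : ℂ) * F a‖ ≤ 1 - ∑ a ∈ A, μ.real {a} := by
  have hint : Integrable F μ :=
    Integrable.of_bound (measurable_of_countable F).aestronglyMeasurable 1 (ae_of_all _ hF)
  have hA : MeasurableSet (A : Set α) := A.measurableSet
  have h1 : ∫ a in (A : Set α), F a ∂μ = ∑ a ∈ A, (μ.real {a} : ℂ) * F a := by
    rw [setIntegral_finset _ hint.integrableOn]
    simp
  rw [← h1, ← integral_add_compl hA hint, add_sub_cancel_left]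
  refine (norm_setIntegral_le_of_norm_le_const (C := 1) (measure_lt_top _ _)
    (fun a _ => hF a)).trans ?_
  rw [one_mul, probReal_compl_eq_one_sub hA]
  simp

/-- If the empirical frequencies of `w 0, …, w (N - 1)` are close to `μ` on a suitable finite set,
then its empirical averages are close to the means under `μ`, uniformly over functions bounded by
one. -/
theorem exists_empirical_average_close {α : Type*} [Countable α] [DecidableEq α]
    [MeasurableSpace α]
    [MeasurableSingletonClass α] (μ : Measure α) [IsProbabilityMeasure μ] {ε : ℝ} (hε : 0 < ε) :
    ∃ A : Finset α, ∃ t : ℝ, 0 < t ∧ ∀ (N : ℕ) (w : ℕ → α),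
      (∀ a ∈ A, |∑ n ∈ Finset.range N, (if w n = a then (1 : ℝ) else 0) - N * μ.real {a}|
        ≤ t * N) →
      ∀ F : α → ℂ, (∀ a, ‖F a‖ ≤ 1) →
        ‖∑ n ∈ Finset.range N, F (w n) - N * ∫ a, F a ∂μ‖ ≤ ε * N := by
  obtain ⟨A, hA⟩ := exists_finset_measureReal_gt μ (show 0 < ε / 4 by positivity)
  -- The total frequency error on `A` is at most `ε/4`, matching the mass `ε/4` of `μ` missed by
  -- `A`.
  refine ⟨A, ε / (4 * (A.card + 1)), by positivity, fun N w hw F hF => ?_⟩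
  set t : ℝ := ε / (4 * (A.card + 1)) with ht
  have htA : A.card * t ≤ ε / 4 := by
    rw [ht, mul_div_assoc', div_le_div_iff₀ (by positivity) (by positivity)]
    nlinarith
  set c : α → ℝ := fun a => ∑ n ∈ Finset.range N, (if w n = a then (1 : ℝ) else 0) with hc
  have hin : ∀ n, (∑ a ∈ A, if w n = a then F a else 0) = if w n ∈ A then F (w n) else 0 :=
    fun n => Finset.sum_ite_eq _ _ _
  have hin' : ∀ n, (∑ a ∈ A, if w n = a then (1 : ℝ) else 0) = if w n ∈ A then 1 else 0 :=
    fun n => Finset.sum_ite_eq A (w n) (fun _ => (1 : ℝ))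
  have hcF : ∑ a ∈ A, (c a : ℂ) * F a
      = ∑ n ∈ Finset.range N, if w n ∈ A then F (w n) else 0 := by
    simp_rw [← hin, hc]
    rw [Finset.sum_comm]
    refine Finset.sum_congr rfl fun a _ => ?_
    push_cast
    rw [Finset.sum_mul]
    exact Finset.sum_congr rfl fun n _ => by split_ifs <;> simp
  have hc1 : ∑ a ∈ A, c a = ∑ n ∈ Finset.range N, if w n ∈ A then (1 : ℝ) else 0 := by
    simp_rw [← hin', hc]
    rw [Finset.sum_comm]
  have hclose : ∑ a ∈ A, |c a - N * μ.real {a}| ≤ ε / 4 * N := by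
    calc _ ≤ ∑ a ∈ A, t * N := Finset.sum_le_sum hw
      _ = A.card * t * N := by rw [Finset.sum_const, nsmul_eq_mul, mul_assoc]
      _ ≤ _ := by gcongr
  -- Near-correct frequencies on `A` already force at most `ε/2` of the empirical mass to lie
  -- outside `A`, so `w` needs no separate tightness.
  have hmass : ∑ a ∈ A, c a ≥ N * (1 - ε / 4) - ε / 4 * N := by
    have h1 : ∑ a ∈ A, (N * μ.real {a} - c a) ≤ ∑ a ∈ A, |c a - N * μ.real {a}| :=
      Finset.sum_le_sum fun a _ => by rw [abs_sub_comm]; exact le_abs_self _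
    rw [Finset.sum_sub_distrib, ← Finset.mul_sum] at h1
    have : (N : ℝ) * (1 - ε / 4) ≤ N * ∑ a ∈ A, μ.real {a} := by gcongr
    linarith
  have hout : ‖∑ n ∈ Finset.range N, F (w n) - ∑ a ∈ A, (c a : ℂ) * F a‖
      ≤ N - ∑ a ∈ A, c a := by
    rw [hcF, hc1, ← Finset.sum_sub_distrib]
    have : (N : ℝ) - ∑ n ∈ Finset.range N, (if w n ∈ A then (1 : ℝ) else 0)
        = ∑ n ∈ Finset.range N, (1 - if w n ∈ A then (1 : ℝ) else 0) := by
      rw [Finset.sum_sub_distrib]; simp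
    rw [this]
    refine norm_sum_le_of_le _ fun n _ => ?_
    split_ifs
    · simp
    · simpa using hF _
  have hmid : ‖∑ a ∈ A, (c a : ℂ) * F a - N * ∑ a ∈ A, (μ.real {a} : ℂ) * F a‖ ≤ ε / 4 * N := by
    rw [Finset.mul_sum, ← Finset.sum_sub_distrib]
    refine (norm_sum_le_of_le _ fun a _ => ?_).trans hclose
    have : (c a : ℂ) * F a - N * ((μ.real {a} : ℂ) * F a)
        = ((c a - N * μ.real {a} : ℝ) : ℂ) * F a := by push_cast; ring
    rw [this, norm_mul, Complex.norm_real, Real.norm_eq_abs]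
    exact mul_le_of_le_one_right (abs_nonneg _) (hF a)
  have hlast : ‖(N : ℂ) * ∑ a ∈ A, (μ.real {a} : ℂ) * F a - N * ∫ a, F a ∂μ‖ ≤ N * (ε / 4) := by
    rw [← mul_sub, norm_mul, Complex.norm_natCast, norm_sub_rev]
    gcongr
    exact (norm_integral_sub_finset_sum_le μ A hF).trans (by linarith)
  have := norm_sub_le_norm_sub_add_norm_sub (∑ n ∈ Finset.range N, F (w n))
    (∑ a ∈ A, (c a : ℂ) * F a) (N * ∫ a, F a ∂μ)
  have := norm_sub_le_norm_sub_add_norm_sub (∑ a ∈ A, (c a : ℂ) * F a)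
    ((N : ℂ) * ∑ a ∈ A, (μ.real {a} : ℂ) * F a) (N * ∫ a, F a ∂μ)
  linarith

/-! ### Mean squares of exponential averages -/

theorem integrable_of_continuous_circle (σ : Measure Circle) [IsFiniteMeasure σ] {f : Circle → ℝ}
    (hf : Continuous f) : Integrable f σ :=
  hf.integrable_of_hasCompactSupport (HasCompactSupport.of_compactSpace f)

theorem norm_average_pow_le_one (e : ℕ → ℕ) (N : ℕ) (z : Circle) :
    ‖(1 / (N : ℂ)) * ∑ n ∈ Finset.Icc 1 N, (z : ℂ) ^ (e n)‖ ≤ 1 := by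
  rcases Nat.eq_zero_or_pos N with rfl | hN
  · simp
  have h : ‖∑ n ∈ Finset.Icc 1 N, (z : ℂ) ^ (e n)‖ ≤ N := by
    simpa using norm_sum_le_of_le (Finset.Icc 1 N) (f := fun n => (z : ℂ) ^ (e n))
      (n := fun _ => (1 : ℝ)) (fun n _ => by rw [norm_pow, Circle.norm_coe, one_pow])
  rw [norm_mul, norm_div, norm_one, Complex.norm_natCast, one_div_mul_eq_div]
  exact div_le_one_of_le₀ h (by positivity)

theorem meanSquare_nonneg (σ : Measure Circle) (e : ℕ → ℕ) (N : ℕ) : 0 ≤ meanSquare σ e N :=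
  integral_nonneg fun _ => by positivity

theorem integrable_sq_norm_average (σ : Measure Circle) [IsFiniteMeasure σ] (e : ℕ → ℕ) (N : ℕ) :
    Integrable
      (fun z : Circle => ‖(1 / (N : ℂ)) * ∑ n ∈ Finset.Icc 1 N, (z : ℂ) ^ (e n)‖ ^ 2) σ :=
  integrable_of_continuous_circle σ (by fun_prop)

theorem meanSquare_le_iSup (σ : Measure Circle) (e : ℕ → ℕ → ℕ) {k N : ℕ} (hk : 1 ≤ k)
    (hkN : k ≤ N) :
    meanSquare σ (e k) N ≤ ⨆ k : Set.Icc 1 N, meanSquare σ (e k) N :=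
  le_ciSup (f := fun k : Set.Icc 1 N => meanSquare σ (e k) N) (Set.finite_range _).bddAbove
    ⟨k, hk, hkN⟩

/-- The mean square is controlled by mean squares along longer averages. -/
theorem meanSquare_mul_le (σ : Measure Circle) [IsFiniteMeasure σ] (k c : ℕ) {N : ℕ} (hN : 0 < N) :
    meanSquare σ (fun n => n * k) N
      ≤ 2 * ((c + 1) ^ 2 * meanSquare σ (fun n => n * k) (c * N + N)
          + c ^ 2 * meanSquare σ (fun n => n * k) (c * N)) := by
  have hN' : (N : ℂ) ≠ 0 := by exact_mod_cast hN.ne'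
  -- The block of exponents with `cN < n ≤ (c+1)N` is a unimodular multiple of the first block, so
  -- the short average is a difference of two long ones.
  have hid : ∀ z : Circle, (c + 1 : ℂ) * ((1 / ((c * N + N : ℕ) : ℂ))
        * ∑ n ∈ Finset.Icc 1 (c * N + N), (z : ℂ) ^ (n * k))
      - c * ((1 / ((c * N : ℕ) : ℂ)) * ∑ n ∈ Finset.Icc 1 (c * N), (z : ℂ) ^ (n * k))
      = (z : ℂ) ^ (c * N * k) * ((1 / (N : ℂ)) * ∑ n ∈ Finset.Icc 1 N, (z : ℂ) ^ (n * k)) := by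
    intro z
    have h1 : (c + 1 : ℂ) * (1 / ((c * N + N : ℕ) : ℂ)) = 1 / N := by
      have : (c + 1 : ℂ) ≠ 0 := by exact_mod_cast Nat.succ_ne_zero c
      push_cast
      rw [show (c * N + N : ℂ) = (c + 1) * N by ring]
      field_simp
    have h2 : (c : ℂ) * ((1 / ((c * N : ℕ) : ℂ))
          * ∑ n ∈ Finset.Icc 1 (c * N), (z : ℂ) ^ (n * k))
        = 1 / N * ∑ n ∈ Finset.Icc 1 (c * N), (z : ℂ) ^ (n * k) := by
      rcases Nat.eq_zero_or_pos c with rfl | hc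
      · simp
      have : (c : ℂ) ≠ 0 := by exact_mod_cast hc.ne'
      push_cast
      field_simp
    have h3 : ∑ n ∈ Finset.Icc 1 (c * N + N), (z : ℂ) ^ (n * k)
        = ∑ n ∈ Finset.Icc 1 (c * N), (z : ℂ) ^ (n * k)
          + (z : ℂ) ^ (c * N * k) * ∑ n ∈ Finset.Icc 1 N, (z : ℂ) ^ (n * k) := by
      simp only [← Finset.Ico_succ_right_eq_Icc, Order.succ_eq_add_one]
      simp only [Finset.sum_Ico_eq_sum_range, Nat.add_sub_cancel]
      rw [Finset.sum_range_add, Finset.mul_sum]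
      congr 1
      exact Finset.sum_congr rfl fun n _ => by rw [← pow_add]; congr 1; ring
    rw [← mul_assoc, h1, h2, h3]
    ring
  have hpt : ∀ z : Circle, ‖(1 / (N : ℂ)) * ∑ n ∈ Finset.Icc 1 N, (z : ℂ) ^ (n * k)‖ ^ 2
      ≤ 2 * ((c + 1) ^ 2 * ‖(1 / ((c * N + N : ℕ) : ℂ))
            * ∑ n ∈ Finset.Icc 1 (c * N + N), (z : ℂ) ^ (n * k)‖ ^ 2
          + c ^ 2 * ‖(1 / ((c * N : ℕ) : ℂ))
            * ∑ n ∈ Finset.Icc 1 (c * N), (z : ℂ) ^ (n * k)‖ ^ 2) := by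
    intro z
    have h1 := congrArg norm (hid z)
    rw [norm_mul ((z : ℂ) ^ (c * N * k)), norm_pow, Circle.norm_coe, one_pow, one_mul] at h1
    rw [← h1]
    set p := (1 / ((c * N + N : ℕ) : ℂ)) * ∑ n ∈ Finset.Icc 1 (c * N + N), (z : ℂ) ^ (n * k)
    set q := (1 / ((c * N : ℕ) : ℂ)) * ∑ n ∈ Finset.Icc 1 (c * N), (z : ℂ) ^ (n * k)
    have h2 := norm_sub_le ((c + 1 : ℂ) * p) (c * q)
    have h3 : ‖(c + 1 : ℂ) * p‖ = (c + 1) * ‖p‖ := by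
      rw [norm_mul]; congr 1; exact_mod_cast Complex.norm_natCast (c + 1)
    have h4 : ‖(c : ℂ) * q‖ = c * ‖q‖ := by simp
    rw [h3, h4] at h2
    have h5 := pow_le_pow_left₀ (norm_nonneg _) h2 2
    nlinarith [sq_nonneg ((c + 1) * ‖p‖ - c * ‖q‖)]
  unfold meanSquare
  have i1 := integrable_sq_norm_average σ (fun n => n * k) (c * N + N)
  have i2 := integrable_sq_norm_average σ (fun n => n * k) (c * N)
  rw [← integral_const_mul, ← integral_const_mul, ← integral_add (i1.const_mul _) (i2.const_mul _),
    ← integral_const_mul]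
  exact integral_mono (integrable_sq_norm_average σ (fun n => n * k) N)
    (((i1.const_mul _).add (i2.const_mul _)).const_mul _) hpt

/-- The frequency `ck` may exceed `N` and so escape the supremum at `N`, but it is at most `cN`,
hence admissible for the averages of lengths `cN` and `(c+1)N`. -/
theorem tendsto_iSup_meanSquare_mul (σ : Measure Circle) [IsFiniteMeasure σ]
    (h : Tendsto (fun N : ℕ => ⨆ k : Set.Icc 1 N, meanSquare σ (fun n => n * (k : ℕ)) N)
      atTop (𝓝 0)) {c : ℕ} (hc : 0 < c) :
    Tendsto (fun N : ℕ => ⨆ k : Set.Icc 1 N, meanSquare σ (fun n => n * (c * (k : ℕ))) N)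
      atTop (𝓝 0) := by
  have t1 : Tendsto (fun N : ℕ => c * N + N) atTop atTop :=
    tendsto_atTop_mono (fun N => Nat.le_add_left N (c * N)) tendsto_id
  have t2 : Tendsto (fun N : ℕ => c * N) atTop atTop :=
    tendsto_atTop_mono (fun N => Nat.le_mul_of_pos_left N hc) tendsto_id
  have hlim := (((h.comp t1).const_mul ((c + 1 : ℝ) ^ 2)).add
    ((h.comp t2).const_mul ((c : ℝ) ^ 2))).const_mul 2
  simp only [mul_zero, add_zero] at hlim
  refine squeeze_zero' (Eventually.of_forall fun N => Real.iSup_nonneg fun k =>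
    meanSquare_nonneg _ _ _) ?_ hlim
  filter_upwards [eventually_ge_atTop 1] with N hN
  have : Nonempty (Set.Icc 1 N) := ⟨⟨1, le_refl _, hN⟩⟩
  refine ciSup_le fun k => (meanSquare_mul_le σ (c * k) c hN).trans ?_
  have hk : 1 ≤ c * (k : ℕ) := Nat.mul_pos hc k.2.1
  have hk' : c * (k : ℕ) ≤ c * N := Nat.mul_le_mul_left c k.2.2
  have h1 := meanSquare_le_iSup σ (fun k n => n * k) hk (hk'.trans (Nat.le_add_right _ N))
  have h2 := meanSquare_le_iSup σ (fun k n => n * k) hk hk'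
  simp only [Function.comp_apply]
  gcongr

/-- On this set the averages along `n·j` equal 1, and `k = j` is admissible as soon as `N ≥ j`. -/
theorem measure_setOf_pow_eq_one (σ : Measure Circle) [IsFiniteMeasure σ]
    (h : Tendsto (fun N : ℕ => ⨆ k : Set.Icc 1 N, meanSquare σ (fun n => n * (k : ℕ)) N)
      atTop (𝓝 0)) {j : ℕ} (hj : 0 < j) : σ {z : Circle | (z : ℂ) ^ j = 1} = 0 := by
  have hmeas : MeasurableSet {z : Circle | (z : ℂ) ^ j = 1} :=
    (isClosed_eq (by fun_prop) continuous_const).measurableSet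
  rw [← measureReal_eq_zero_iff]
  refine le_antisymm ?_ measureReal_nonneg
  refine ge_of_tendsto h ?_
  filter_upwards [eventually_ge_atTop j] with N hN
  refine le_trans ?_ (meanSquare_le_iSup σ (fun k n => n * k) hj hN)
  have hN' : (N : ℂ) ≠ 0 := by exact_mod_cast (by omega)
  rw [← integral_indicator_one hmeas]
  refine integral_mono ((integrable_const (1 : ℝ)).indicator hmeas)
    (integrable_sq_norm_average σ (fun n => n * j) N) fun z => ?_
  by_cases hz : (z : ℂ) ^ j = 1
  · have : ∀ n : ℕ, (z : ℂ) ^ (n * j) = 1 := fun n => by rw [mul_comm, pow_mul, hz, one_pow]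
    simp [this, hz, hN']
  · simp only [Set.indicator, Set.mem_ofPred_eq, hz, if_false]
    positivity

/-! ### An exponential inequality for martingale differences -/

section Azuma

variable {Ω : Type*} [MeasurableSpace Ω] {P : Measure Ω} {ξ : ℕ → Ω → ℝ}

theorem integrable_exp_mul_sum [IsFiniteMeasure P] (hm : ∀ n, Measurable (ξ n))
    (hb : ∀ n ω, |ξ n ω| ≤ 1) (c : ℝ) (N : ℕ) :
    Integrable (fun ω => Real.exp (c * ∑ i ∈ Finset.range N, ξ i ω)) P := by
  refine Integrable.of_bound (C := Real.exp (|c| * N)) (by fun_prop) (ae_of_all _ fun ω => ?_)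
  rw [Real.norm_of_nonneg (Real.exp_pos _).le, Real.exp_le_exp]
  refine (le_abs_self _).trans ?_
  rw [abs_mul]
  gcongr
  refine (Finset.abs_sum_le_sum_abs _ _).trans ?_
  simpa using Finset.sum_le_sum (fun i (_ : i ∈ Finset.range N) => hb i ω)

/-- Induction using `exp(cx) ≤ cx + exp(c²)`, whose linear term integrates to zero. The martingale
property is needed only when tested against exponentials of the past sum, which is the form of `h0`.
-/
theorem integral_exp_mul_sum_le [IsProbabilityMeasure P] (hm : ∀ n, Measurable (ξ n))
    (hb : ∀ n ω, |ξ n ω| ≤ 1)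
    (h0 : ∀ (n : ℕ) (c : ℝ), ∫ ω, Real.exp (c * ∑ i ∈ Finset.range n, ξ i ω) * ξ n ω ∂P = 0)
    {c : ℝ} (hc : |c| ≤ 1) (N : ℕ) :
    ∫ ω, Real.exp (c * ∑ i ∈ Finset.range N, ξ i ω) ∂P ≤ Real.exp (c ^ 2 * N) := by
  induction N with
  | zero => simp
  | succ N ih =>
    set E : Ω → ℝ := fun ω => Real.exp (c * ∑ i ∈ Finset.range N, ξ i ω) with hE
    have hEint : Integrable E P := integrable_exp_mul_sum hm hb c N
    have hEξ : Integrable (fun ω => E ω * ξ N ω) P :=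
      hEint.mul_bdd (c := 1) (hm N).aestronglyMeasurable (ae_of_all _ fun ω => hb N ω)
    have hstep : ∀ x : ℝ, |x| ≤ 1 → Real.exp (c * x) ≤ c * x + Real.exp (c ^ 2) := by
      intro x hx
      have h1 : |c * x| ≤ 1 := by rw [abs_mul]; exact mul_le_one₀ hc (abs_nonneg _) hx
      have h2 := (abs_le.1 (Real.abs_exp_sub_one_sub_id_le h1)).2
      have h3 : (c * x) ^ 2 ≤ c ^ 2 := by
        rw [mul_pow]
        exact mul_le_of_le_one_right (sq_nonneg _) ((sq_le_one_iff_abs_le_one x).2 hx)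
      linarith [Real.add_one_le_exp (c ^ 2)]
    have h1 : ∫ ω, Real.exp (c * ∑ i ∈ Finset.range (N + 1), ξ i ω) ∂P
        ≤ ∫ ω, (c * (E ω * ξ N ω) + Real.exp (c ^ 2) * E ω) ∂P := by
      refine integral_mono (integrable_exp_mul_sum hm hb c (N + 1))
        ((hEξ.const_mul c).add (hEint.const_mul _)) fun ω => ?_
      simp only [Finset.sum_range_succ, mul_add, Real.exp_add]
      calc E ω * Real.exp (c * ξ N ω) ≤ E ω * (c * ξ N ω + Real.exp (c ^ 2)) :=
            mul_le_mul_of_nonneg_left (hstep _ (hb N ω)) (Real.exp_pos _).le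
        _ = _ := by ring
    refine h1.trans ?_
    rw [integral_add (hEξ.const_mul c) (hEint.const_mul _), integral_const_mul, integral_const_mul,
      h0 N c, mul_zero, zero_add]
    calc _ ≤ Real.exp (c ^ 2) * Real.exp (c ^ 2 * N) :=
          mul_le_mul_of_nonneg_left ih (Real.exp_pos _).le
      _ = _ := by rw [← Real.exp_add]; congr 1; push_cast; ring

/-- Chernoff's bound at the parameters `±t/2`, which are optimal for the moment bound `exp(c²N)`. -/
theorem measureReal_abs_sum_ge_le [IsProbabilityMeasure P] (hm : ∀ n, Measurable (ξ n))
    (hb : ∀ n ω, |ξ n ω| ≤ 1)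
    (h0 : ∀ (n : ℕ) (c : ℝ), ∫ ω, Real.exp (c * ∑ i ∈ Finset.range n, ξ i ω) * ξ n ω ∂P = 0)
    {t : ℝ} (ht : 0 ≤ t) (ht1 : t ≤ 1) (N : ℕ) :
    P.real {ω | t * N ≤ |∑ i ∈ Finset.range N, ξ i ω|} ≤ 2 * Real.exp (-(t ^ 2 / 4)) ^ N := by
  have hsub : {ω | t * N ≤ |∑ i ∈ Finset.range N, ξ i ω|}
      ⊆ {ω | t * N ≤ ∑ i ∈ Finset.range N, ξ i ω}
        ∪ {ω | ∑ i ∈ Finset.range N, ξ i ω ≤ -(t * N)} := by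
    intro ω hω
    rcases le_abs'.1 (show t * N ≤ |∑ i ∈ Finset.range N, ξ i ω| from hω) with h | h
    · exact Or.inr h
    · exact Or.inl h
  have h1 := measure_ge_le_exp_mul_mgf (μ := P) (X := fun ω => ∑ i ∈ Finset.range N, ξ i ω)
    (t := t / 2) (t * N) (by linarith) (integrable_exp_mul_sum hm hb _ N)
  have h2 := measure_le_le_exp_mul_mgf (μ := P) (X := fun ω => ∑ i ∈ Finset.range N, ξ i ω)
    (t := -(t / 2)) (-(t * N)) (by linarith) (integrable_exp_mul_sum hm hb _ N)
  have h3 := integral_exp_mul_sum_le hm hb h0 (c := t / 2) (by rw [abs_le]; constructor <;> linarith) N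
  have h4 := integral_exp_mul_sum_le hm hb h0 (c := -(t / 2))
    (by rw [abs_le]; constructor <;> linarith) N
  have h5 : Real.exp (-(t / 2) * (t * N)) * Real.exp ((t / 2) ^ 2 * N)
      = Real.exp (-(t ^ 2 / 4)) ^ N := by
    rw [← Real.exp_add, ← Real.exp_nat_mul]; congr 1; ring
  have h6 : Real.exp (- -(t / 2) * -(t * N)) * Real.exp ((-(t / 2)) ^ 2 * N)
      = Real.exp (-(t ^ 2 / 4)) ^ N := by
    rw [← Real.exp_add, ← Real.exp_nat_mul]; congr 1; ring
  have h7 := h1.trans (mul_le_mul_of_nonneg_left h3 (Real.exp_pos _).le)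
  have h8 := h2.trans (mul_le_mul_of_nonneg_left h4 (Real.exp_pos _).le)
  rw [h5] at h7
  rw [h6] at h8
  refine (measureReal_mono hsub).trans ((measureReal_union_le _ _).trans ?_)
  linarith

end Azuma

/-- Borel–Cantelli: level `N` has `m(N+1)` events, and `N q^N` is summable. -/
theorem ae_eventually_forall_notMem {Ω : Type*} [MeasurableSpace Ω] {P : Measure Ω}
    [IsFiniteMeasure P] {B : ℕ → ℕ → ℕ → Set Ω} (m : ℕ) {q : ℝ} (hq0 : 0 ≤ q) (hq1 : q < 1)
    (hB : ∀ N k r, P.real (B N k r) ≤ 2 * q ^ N) :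
    ∀ᵐ x ∂P, ∀ᶠ N : ℕ in atTop, ∀ k ∈ Finset.range (N + 1), ∀ r ∈ Finset.range m, x ∉ B N k r := by
  have hbound : ∀ N, P.real (⋃ k ∈ Finset.range (N + 1), ⋃ r ∈ Finset.range m, B N k r)
      ≤ 2 * m * ((N : ℝ) ^ 1 * q ^ N + q ^ N) := by
    intro N
    refine (measureReal_biUnion_finset_le _ _).trans ?_
    refine (Finset.sum_le_sum fun k _ => (measureReal_biUnion_finset_le _ _).trans
      (Finset.sum_le_sum fun r _ => hB N k r)).trans ?_
    simp only [Finset.sum_const, Finset.card_range, nsmul_eq_mul]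
    exact le_of_eq (by push_cast; ring)
  have hq : ‖q‖ < 1 := by rwa [Real.norm_of_nonneg hq0]
  have hsum : Summable fun N : ℕ => 2 * m * ((N : ℝ) ^ 1 * q ^ N + q ^ N) :=
    ((summable_pow_mul_geometric_of_norm_lt_one 1 hq).add
      (summable_geometric_of_lt_one hq0 hq1)).mul_left _
  have hfin : ∑' N, P (⋃ k ∈ Finset.range (N + 1), ⋃ r ∈ Finset.range m, B N k r) ≠ ⊤ := by
    have h1 := Summable.of_nonneg_of_le (fun _ => measureReal_nonneg) hbound hsum
    have h2 : ∀ N, P (⋃ k ∈ Finset.range (N + 1), ⋃ r ∈ Finset.range m, B N k r)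
        = ENNReal.ofReal (P.real (⋃ k ∈ Finset.range (N + 1), ⋃ r ∈ Finset.range m, B N k r)) :=
      fun N => (ofReal_measureReal (measure_ne_top _ _)).symm
    rw [tsum_congr h2, ← ENNReal.ofReal_tsum_of_nonneg (fun _ => measureReal_nonneg) h1]
    exact ENNReal.ofReal_ne_top
  filter_upwards [ae_eventually_notMem hfin] with x hx
  filter_upwards [hx] with N hN k hk r hr hcon
  refine hN ?_
  simp only [Set.mem_iUnion]
  exact ⟨k, hk, r, hr, hcon⟩

/-! ### Functions of finitely many independent coordinates -/

/-- The sequence `x` shifted by `n`. -/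
def shiftSeq (n : ℕ) (x : ℕ → ℕ) : ℕ → ℕ := fun i => x (n + i)

theorem measurable_shiftSeq (n : ℕ) : Measurable (shiftSeq n) :=
  measurable_pi_iff.2 fun i => measurable_pi_apply (n + i)

theorem DependsOn.exists_eq_comp_restrict {β : Type*} [Nonempty β] {f : (ℕ → ℕ) → β}
    {s : Finset ℕ} (hf : DependsOn f s) :
    ∃ φ : (s → ℕ) → β, f = fun x => φ (fun i => x i) :=
  dependsOn_iff_exists_comp.1 hf

/-- Such a function factors through a countable discrete space, so measurability comes for free. -/
theorem DependsOn.measurable_of_finset {β : Type*} [Nonempty β] [MeasurableSpace β]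
    {f : (ℕ → ℕ) → β} {s : Finset ℕ} (hf : DependsOn f s) : Measurable f := by
  obtain ⟨φ, rfl⟩ := hf.exists_eq_comp_restrict
  exact (measurable_of_countable φ).comp
    (measurable_pi_iff.2 fun i => measurable_pi_apply (i : ℕ))

theorem DependsOn.comp_shiftSeq {β : Type*} {f : (ℕ → ℕ) → β} {m : ℕ}
    (hf : DependsOn f (Finset.range m : Set ℕ)) (n : ℕ) :
    DependsOn (fun x => f (shiftSeq n x)) (Finset.Ico n (n + m) : Set ℕ) := by
  intro x y hxy
  refine hf fun i hi => hxy _ ?_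
  simp only [Finset.coe_range, Set.mem_Iio, Finset.coe_Ico, Set.mem_Ico] at hi ⊢
  omega

section Product

variable (μ : Measure ℕ) [IsProbabilityMeasure μ]

theorem map_shiftSeq_infinitePi (n : ℕ) :
    (Measure.infinitePi fun _ : ℕ => μ).map (shiftSeq n) = Measure.infinitePi fun _ : ℕ => μ :=
  Measure.map_infinitePi_infinitePi_of_inj (P := fun _ : ℕ => μ) (f := fun i => n + i)
    (add_right_injective n)

theorem iIndepFun_eval_infinitePi :
    iIndepFun (fun (i : ℕ) (x : ℕ → ℕ) => x i) (Measure.infinitePi fun _ : ℕ => μ) :=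
  iIndepFun_infinitePi (P := fun _ : ℕ => μ) (X := fun _ x => x) fun _ => measurable_id

theorem integral_mul_of_dependsOn {f g : (ℕ → ℕ) → ℝ} {s t : Finset ℕ} (hst : Disjoint s t)
    (hf : DependsOn f s) (hg : DependsOn g t) :
    ∫ x, f x * g x ∂(Measure.infinitePi fun _ : ℕ => μ)
      = (∫ x, f x ∂(Measure.infinitePi fun _ : ℕ => μ))
        * ∫ x, g x ∂(Measure.infinitePi fun _ : ℕ => μ) := by
  obtain ⟨φ, rfl⟩ := hf.exists_eq_comp_restrict
  obtain ⟨ψ, rfl⟩ := hg.exists_eq_comp_restrict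
  exact ((iIndepFun_eval_infinitePi μ).indepFun_finset s t hst
    fun i => measurable_pi_apply i).integral_fun_comp_mul_comp
      (measurable_pi_iff.2 fun i : s => measurable_pi_apply (i : ℕ)).aemeasurable
      (measurable_pi_iff.2 fun i : t => measurable_pi_apply (i : ℕ)).aemeasurable
      (measurable_of_countable φ).aestronglyMeasurable
      (measurable_of_countable ψ).aestronglyMeasurable

theorem integral_comp_shiftSeq {f : (ℕ → ℕ) → ℝ} (hf : Measurable f) (n : ℕ) :
    ∫ x, f (shiftSeq n x) ∂(Measure.infinitePi fun _ : ℕ => μ)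
      = ∫ x, f x ∂(Measure.infinitePi fun _ : ℕ => μ) := by
  conv_rhs => rw [← map_shiftSeq_infinitePi μ n]
  rw [integral_map (measurable_shiftSeq n).aemeasurable hf.aestronglyMeasurable]

variable {G : (ℕ → ℕ) → ℝ} {m : ℕ} {C : ℕ → ℕ → (ℕ → ℕ) → ℝ}

/-- The increments along a residue class modulo the block length are martingale differences. -/
theorem integral_exp_mul_residue_sum_eq_zero (hG : DependsOn G (Finset.range m : Set ℕ))
    (hG0 : ∫ x, G x ∂(Measure.infinitePi fun _ : ℕ => μ) = 0)
    (hC : ∀ k n, DependsOn (C k n) (Finset.range (n + k) : Set ℕ)) (r k n : ℕ) (c : ℝ) :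
    ∫ x, Real.exp (c * ∑ i ∈ Finset.range n,
        if i % m = r then G (shiftSeq (i + k) x) * C k i x else 0)
      * (if n % m = r then G (shiftSeq (n + k) x) * C k n x else 0)
      ∂(Measure.infinitePi fun _ : ℕ => μ) = 0 := by
  by_cases hn : n % m = r
  swap
  · simp [hn]
  simp only [hn, if_true]
  have hU : DependsOn (fun x => Real.exp (c * ∑ i ∈ Finset.range n,
      if i % m = r then G (shiftSeq (i + k) x) * C k i x else 0) * C k n x)
      (Finset.range (n + k) : Set ℕ) := by
    intro x y hxy
    have hsum : ∀ i ∈ Finset.range n,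
        (if i % m = r then G (shiftSeq (i + k) x) * C k i x else 0)
          = if i % m = r then G (shiftSeq (i + k) y) * C k i y else 0 := by
      intro i hi
      rw [Finset.mem_range] at hi
      split_ifs with him
      -- Earlier indices in the same residue class are at least `m` back, so their blocks end before
      -- coordinate `n + k`, where the current block begins.
      · have hlt : i + m ≤ n := by
          have hmod : i % m = n % m := by rw [him, hn]
          have hdvd := (Nat.modEq_iff_dvd' hi.le).1 hmod
          have := Nat.le_of_dvd (by omega) hdvd
          omega
        have h1 : G (shiftSeq (i + k) x) = G (shiftSeq (i + k) y) :=
          (hG.comp_shiftSeq (i + k)) fun j hj => hxy j (by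
            simp only [Finset.coe_range, Set.mem_Iio, Finset.coe_Ico, Set.mem_Ico] at hj ⊢
            omega)
        have h2 : C k i x = C k i y := hC k i fun j hj => hxy j (by
            simp only [Finset.coe_range, Set.mem_Iio] at hj ⊢
            omega)
        rw [h1, h2]
      · rfl
    simp only [Finset.sum_congr rfl hsum, hC k n hxy]
  have hX := hG.comp_shiftSeq (n + k)
  have hdisj : Disjoint (Finset.range (n + k)) (Finset.Ico (n + k) (n + k + m)) := by
    rw [Finset.disjoint_left]
    intro i hi hi'
    rw [Finset.mem_range] at hi
    rw [Finset.mem_Ico] at hi'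
    omega
  have h := integral_mul_of_dependsOn μ hdisj hU hX
  rw [integral_comp_shiftSeq μ hG.measurable_of_finset, hG0, mul_zero] at h
  refine Eq.trans (integral_congr_ae (ae_of_all _ fun x => ?_)) h
  beta_reduce
  rw [mul_comm (G _), mul_assoc]

theorem measureReal_residue_sum_ge_le (hG : DependsOn G (Finset.range m : Set ℕ))
    (hGb : ∀ x, |G x| ≤ 1) (hG0 : ∫ x, G x ∂(Measure.infinitePi fun _ : ℕ => μ) = 0)
    (hC : ∀ k n, DependsOn (C k n) (Finset.range (n + k) : Set ℕ)) (hCb : ∀ k n x, |C k n x| ≤ 1)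
    {t : ℝ} (ht : 0 ≤ t) (ht1 : t ≤ 1) (r k N : ℕ) :
    (Measure.infinitePi fun _ : ℕ => μ).real {x | t * N ≤ |∑ i ∈ Finset.range N,
        if i % m = r then G (shiftSeq (i + k) x) * C k i x else 0|}
      ≤ 2 * Real.exp (-(t ^ 2 / 4)) ^ N := by
  refine measureReal_abs_sum_ge_le (ξ := fun i x =>
    if i % m = r then G (shiftSeq (i + k) x) * C k i x else 0) (fun n => ?_) (fun n x => ?_)
    (fun n c => integral_exp_mul_residue_sum_eq_zero μ hG hG0 hC r k n c) ht ht1 N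
  · split_ifs
    · exact (hG.measurable_of_finset.comp (measurable_shiftSeq _)).mul (hC k n).measurable_of_finset
    · exact measurable_const
  · split_ifs
    · rw [abs_mul]
      exact mul_le_one₀ (hGb _) (abs_nonneg _) (hCb _ _ _)
    · simp

theorem ae_eventually_residue_sums_lt (hG : DependsOn G (Finset.range m : Set ℕ))
    (hGb : ∀ x, |G x| ≤ 1) (hG0 : ∫ x, G x ∂(Measure.infinitePi fun _ : ℕ => μ) = 0)
    (hC : ∀ k n, DependsOn (C k n) (Finset.range (n + k) : Set ℕ)) (hCb : ∀ k n x, |C k n x| ≤ 1)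
    {t : ℝ} (ht : 0 < t) (ht1 : t ≤ 1) :
    ∀ᵐ x ∂(Measure.infinitePi fun _ : ℕ => μ), ∀ᶠ N : ℕ in atTop, ∀ k ∈ Finset.range (N + 1),
      ∀ r ∈ Finset.range m, |∑ i ∈ Finset.range N,
        if i % m = r then G (shiftSeq (i + k) x) * C k i x else 0| < t * N := by
  filter_upwards [ae_eventually_forall_notMem
    (B := fun N k r => {x | t * N ≤ |∑ i ∈ Finset.range N,
        if i % m = r then G (shiftSeq (i + k) x) * C k i x else 0|}) m
    (Real.exp_pos (-(t ^ 2 / 4))).le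
    (by rw [Real.exp_lt_one_iff, neg_lt_zero]; positivity)
    fun N k r => measureReal_residue_sum_ge_le μ hG hGb hG0 hC hCb ht.le ht1 r k N] with x hx
  filter_upwards [hx] with N hN k hk r hr
  exact not_le.1 (hN k hk r hr)

/-- A law of large numbers, uniform over the possible shifts `k ≤ N`. -/
theorem ae_eventually_sum_mul_le (hG : DependsOn G (Finset.range m : Set ℕ))
    (hGb : ∀ x, |G x| ≤ 1) (hG0 : ∫ x, G x ∂(Measure.infinitePi fun _ : ℕ => μ) = 0)
    (hC : ∀ k n, DependsOn (C k n) (Finset.range (n + k) : Set ℕ))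
    (hCb : ∀ k n x, |C k n x| ≤ 1) (hm : 0 < m) :
    ∀ᵐ x ∂(Measure.infinitePi fun _ : ℕ => μ), ∀ t : ℝ, 0 < t → ∀ᶠ N : ℕ in atTop, ∀ k ≤ N,
      |∑ i ∈ Finset.range N, G (shiftSeq (i + k) x) * C k i x| ≤ t * N := by
  -- Countably many thresholds suffice, so one null set serves all `t`.
  have h := ae_all_iff.2 fun j : ℕ => ae_eventually_residue_sums_lt μ hG hGb hG0 hC hCb
    (t := 1 / ((j : ℝ) + 1)) Nat.one_div_pos_of_nat
    (by rw [div_le_one (by positivity)]; linarith [(Nat.cast_nonneg j : (0 : ℝ) ≤ j)])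
  filter_upwards [h] with x hx t ht
  obtain ⟨j, hj⟩ := exists_nat_one_div_lt (show 0 < t / m by positivity)
  filter_upwards [hx j] with N hN k hk
  have hdecomp : ∑ i ∈ Finset.range N, G (shiftSeq (i + k) x) * C k i x
      = ∑ r ∈ Finset.range m, ∑ i ∈ Finset.range N,
        if i % m = r then G (shiftSeq (i + k) x) * C k i x else 0 := by
    rw [Finset.sum_comm]
    refine Finset.sum_congr rfl fun i _ => ?_
    rw [Finset.sum_ite_eq, if_pos (Finset.mem_range.2 (Nat.mod_lt _ hm))]
  rw [hdecomp]
  refine (Finset.abs_sum_le_sum_abs _ _).trans ?_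
  calc _ ≤ ∑ r ∈ Finset.range m, t / m * N := Finset.sum_le_sum fun r hr =>
        (hN k (Finset.mem_range.2 (Nat.lt_succ_of_le hk)) r hr).le.trans (by gcongr)
    _ = t * N := by
      rw [Finset.sum_const, Finset.card_range, nsmul_eq_mul]
      field_simp

end Product

/-! ### Uniform convergence of empirical averages of block functions -/

section Empirical

variable (μ : Measure ℕ) {g : (ℕ → ℕ) → ℕ} {m : ℕ}

/-- The law of a function of an independent sequence with common law `μ`. -/
noncomputable def blockLaw (g : (ℕ → ℕ) → ℕ) : Measure ℕ :=
  (Measure.infinitePi fun _ : ℕ => μ).map g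

/-- The centred indicator of `g = a`. -/
noncomputable def centredIndicator (g : (ℕ → ℕ) → ℕ) (a : ℕ) (x : ℕ → ℕ) : ℝ :=
  (if g x = a then (1 : ℝ) else 0) - (blockLaw μ g).real {a}

theorem dependsOn_centredIndicator (hg : DependsOn g (Finset.range m : Set ℕ)) (a : ℕ) :
    DependsOn (centredIndicator μ g a) (Finset.range m : Set ℕ) := fun x y hxy => by
  simp only [centredIndicator, hg hxy]

variable [IsProbabilityMeasure μ]

theorem isProbabilityMeasure_blockLaw (hg : Measurable g) :
    IsProbabilityMeasure (blockLaw μ g) :=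
  Measure.isProbabilityMeasure_map hg.aemeasurable

theorem abs_centredIndicator_le (hg : Measurable g) (a : ℕ) (x : ℕ → ℕ) :
    |centredIndicator μ g a x| ≤ 1 := by
  have := isProbabilityMeasure_blockLaw μ hg
  have h1 : (blockLaw μ g).real {a} ≤ 1 := measureReal_le_one
  have h2 : 0 ≤ (blockLaw μ g).real {a} := measureReal_nonneg
  unfold centredIndicator
  rw [abs_le]
  split_ifs <;> constructor <;> linarith

theorem integral_centredIndicator (hg : Measurable g) (a : ℕ) :
    ∫ x, centredIndicator μ g a x ∂(Measure.infinitePi fun _ : ℕ => μ) = 0 := by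
  have hset : MeasurableSet (g ⁻¹' {a}) := hg (measurableSet_singleton a)
  have h1 : (fun x => if g x = a then (1 : ℝ) else 0) = (g ⁻¹' {a}).indicator 1 := by
    ext x
    simp [Set.indicator]
  have hint : Integrable (fun x => if g x = a then (1 : ℝ) else 0)
      (Measure.infinitePi fun _ : ℕ => μ) := by
    rw [h1]
    exact (integrable_const (1 : ℝ)).indicator hset
  unfold centredIndicator
  rw [integral_sub hint (integrable_const _), h1, integral_indicator_one hset, blockLaw,
    map_measureReal_apply hg (measurableSet_singleton a)]
  simp

theorem ae_eventually_abs_sum_centredIndicator_le (hg : DependsOn g (Finset.range m : Set ℕ))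
    (hm : 0 < m) :
    ∀ᵐ x ∂(Measure.infinitePi fun _ : ℕ => μ), ∀ a : ℕ, ∀ t : ℝ, 0 < t → ∀ᶠ N : ℕ in atTop,
      |∑ i ∈ Finset.range N, centredIndicator μ g a (shiftSeq i x)| ≤ t * N := by
  rw [ae_all_iff]
  intro a
  have h := ae_eventually_sum_mul_le μ (C := fun _ _ _ => 1) (dependsOn_centredIndicator μ hg a)
    (abs_centredIndicator_le μ hg.measurable_of_finset a)
    (integral_centredIndicator μ hg.measurable_of_finset a)
    (fun _ _ => fun _ _ _ => rfl) (by simp) hm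
  filter_upwards [h] with x hx t ht
  filter_upwards [hx t ht] with N hN
  simpa using hN 0 (Nat.zero_le N)

/-- The indicator of the block at `n` is determined before coordinate `n + k` once `m ≤ k`; for
smaller `k` the multiplier is set to 0 so that the dependence condition holds for every `k`. -/
theorem ae_eventually_abs_sum_centredIndicator_mul_le
    (hg : DependsOn g (Finset.range m : Set ℕ)) (hm : 0 < m) :
    ∀ᵐ x ∂(Measure.infinitePi fun _ : ℕ => μ), ∀ a b : ℕ, ∀ t : ℝ, 0 < t → ∀ᶠ N : ℕ in atTop,
      ∀ k, m ≤ k → k ≤ N → |∑ i ∈ Finset.range N, centredIndicator μ g a (shiftSeq (i + k) x)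
        * (if g (shiftSeq i x) = b then (1 : ℝ) else 0)| ≤ t * N := by
  rw [ae_all_iff]
  intro a
  rw [ae_all_iff]
  intro b
  have h := ae_eventually_sum_mul_le μ
    (C := fun k n x => if m ≤ k then (if g (shiftSeq n x) = b then (1 : ℝ) else 0) else 0)
    (dependsOn_centredIndicator μ hg a)
    (abs_centredIndicator_le μ hg.measurable_of_finset a)
    (integral_centredIndicator μ hg.measurable_of_finset a)
    (fun k n => fun x y hxy => ?_) (fun k n x => by split_ifs <;> simp) hm
  · filter_upwards [h] with x hx t ht
    filter_upwards [hx t ht] with N hN k hmk hkN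
    simpa only [hmk, if_true] using hN k hkN
  · by_cases hmk : m ≤ k
    · have h1 : g (shiftSeq n x) = g (shiftSeq n y) := hg.comp_shiftSeq n fun j hj => hxy j (by
        simp only [Finset.coe_range, Set.mem_Iio, Finset.coe_Ico, Set.mem_Ico] at hj ⊢
        omega)
      simp only [h1]
    · simp only [hmk, if_false]

theorem ae_eventually_empirical_close (hg : DependsOn g (Finset.range m : Set ℕ)) (hm : 0 < m) :
    ∀ᵐ x ∂(Measure.infinitePi fun _ : ℕ => μ), ∀ ε : ℝ, 0 < ε → ∀ᶠ N : ℕ in atTop,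
      ∀ F : ℕ → ℂ, (∀ a, ‖F a‖ ≤ 1) →
        ‖∑ n ∈ Finset.range N, F (g (shiftSeq n x)) - N * ∫ a, F a ∂(blockLaw μ g)‖ ≤ ε * N := by
  have := isProbabilityMeasure_blockLaw μ hg.measurable_of_finset
  filter_upwards [ae_eventually_abs_sum_centredIndicator_le μ hg hm] with x hx ε hε
  obtain ⟨A, t, ht, h⟩ := exists_empirical_average_close (blockLaw μ g) hε
  filter_upwards [(Finset.eventually_all A).2 fun a _ => hx a t ht] with N hN F hF
  refine h N (fun n => g (shiftSeq n x)) (fun a ha => ?_) F hF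
  refine le_of_eq_of_le ?_ (hN a ha)
  simp [centredIndicator, Finset.sum_sub_distrib]

theorem ae_eventually_empirical_pair_close (hg : DependsOn g (Finset.range m : Set ℕ))
    (hm : 0 < m) :
    ∀ᵐ x ∂(Measure.infinitePi fun _ : ℕ => μ), ∀ ε : ℝ, 0 < ε → ∀ᶠ N : ℕ in atTop,
      ∀ k, m ≤ k → k ≤ N → ∀ F : ℕ × ℕ → ℂ, (∀ a, ‖F a‖ ≤ 1) →
        ‖∑ n ∈ Finset.range N, F (g (shiftSeq (n + k) x), g (shiftSeq n x))
          - N * ∫ a, F a ∂((blockLaw μ g).prod (blockLaw μ g))‖ ≤ ε * N := by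
  have := isProbabilityMeasure_blockLaw μ hg.measurable_of_finset
  filter_upwards [ae_eventually_abs_sum_centredIndicator_le μ hg hm,
    ae_eventually_abs_sum_centredIndicator_mul_le μ hg hm] with x hx hx' ε hε
  obtain ⟨A, t, ht, h⟩ :=
    exists_empirical_average_close ((blockLaw μ g).prod (blockLaw μ g)) hε
  filter_upwards [(Finset.eventually_all A).2 fun a _ => hx a.2 (t / 2) (half_pos ht),
    (Finset.eventually_all A).2 fun a _ => hx' a.1 a.2 (t / 2) (half_pos ht)]
    with N hN hN' k hmk hkN F hF
  refine h N (fun n => (g (shiftSeq (n + k) x), g (shiftSeq n x))) (fun a ha => ?_) F hF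
  obtain ⟨a, b⟩ := a
  have hprod : ((blockLaw μ g).prod (blockLaw μ g)).real {(a, b)}
      = (blockLaw μ g).real {a} * (blockLaw μ g).real {b} := by
    rw [← Set.singleton_prod_singleton, measureReal_prod_prod]
  set p := (blockLaw μ g).real {a} with hp
  -- This is `1_a 1_b - p_a p_b = (1_a - p_a) 1_b + p_a (1_b - p_b)`; each part gets `t/2`.
  have hsum : ∑ n ∈ Finset.range N,
        (if (g (shiftSeq (n + k) x), g (shiftSeq n x)) = (a, b) then (1 : ℝ) else 0)
        - N * ((blockLaw μ g).prod (blockLaw μ g)).real {(a, b)}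
      = (∑ i ∈ Finset.range N, centredIndicator μ g a (shiftSeq (i + k) x)
          * (if g (shiftSeq i x) = b then (1 : ℝ) else 0))
        + p * ∑ i ∈ Finset.range N, centredIndicator μ g b (shiftSeq i x) := by
    have hN : (N : ℝ) * ((blockLaw μ g).prod (blockLaw μ g)).real {(a, b)}
        = ∑ n ∈ Finset.range N, p * (blockLaw μ g).real {b} := by
      rw [hprod]; simp
    rw [hN, Finset.mul_sum, ← Finset.sum_sub_distrib, ← Finset.sum_add_distrib]
    refine Finset.sum_congr rfl fun n _ => ?_
    simp only [centredIndicator, Prod.mk.injEq, ← hp]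
    by_cases h1 : g (shiftSeq (n + k) x) = a <;> by_cases h2 : g (shiftSeq n x) = b <;>
      simp [h1, h2] <;> ring
  rw [hsum]
  have hp1 : p ≤ 1 := measureReal_le_one
  have hp0 : 0 ≤ p := measureReal_nonneg
  refine (abs_add_le _ _).trans ?_
  rw [abs_mul, abs_of_nonneg hp0]
  have h1 := hN' (a, b) ha k hmk hkN
  have h2 := hN (a, b) ha
  have h3 := mul_le_of_le_one_left (abs_nonneg
    (∑ i ∈ Finset.range N, centredIndicator μ g b (shiftSeq i x))) hp1
  dsimp only at h1 h2
  linarith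

end Empirical

/-! ### The characteristic function of an integer-valued law -/

/-- The mean of `w ^ n` for `n` distributed according to `μ`. -/
noncomputable def powMean (μ : Measure ℕ) (w : ℂ) : ℂ := ∫ n, w ^ n ∂μ

section PowMean

variable (μ : Measure ℕ) [IsProbabilityMeasure μ]

theorem norm_powMean_le_one {w : ℂ} (hw : ‖w‖ = 1) : ‖powMean μ w‖ ≤ 1 := by
  have := norm_integral_le_of_norm_le_const (μ := μ) (f := fun n : ℕ => w ^ n) (C := 1)
    (ae_of_all _ fun n => by rw [norm_pow, hw, one_pow])
  simpa [powMean] using this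

theorem norm_add_le_of_norm_eq_one {a b : ℂ} (ha : ‖a‖ = 1) (hb : ‖b‖ = 1) :
    ‖a + b‖ ≤ 2 - ‖a - b‖ ^ 2 / 4 := by
  have h1 := parallelogram_law_with_norm ℝ a b
  have h2 : ‖a + b‖ ≤ 2 := (norm_add_le a b).trans (by rw [ha, hb]; norm_num)
  rw [ha, hb] at h1
  nlinarith [norm_nonneg (a + b)]

/-- Two distinct atoms of `μ` quantify how far the mean of `w ^ n` lies inside the unit disc. -/
theorem exists_norm_powMean_le {u v : ℕ} (huv : u ≠ v) (hu : μ {u} ≠ 0) (hv : μ {v} ≠ 0) :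
    ∃ p : ℝ, 0 < p ∧ p ≤ 1 ∧ ∀ w : ℂ, ‖w‖ = 1 → ‖powMean μ w‖ ≤ 1 - p * ‖w ^ u - w ^ v‖ ^ 2 := by
  have hu0 : 0 < μ.real {u} := ENNReal.toReal_pos hu (measure_ne_top _ _)
  have hv0 : 0 < μ.real {v} := ENNReal.toReal_pos hv (measure_ne_top _ _)
  set p := min (μ.real {u}) (μ.real {v}) with hp
  have hp0 : 0 < p := lt_min hu0 hv0
  have hp1 : p ≤ 1 := (min_le_left _ _).trans measureReal_le_one
  refine ⟨p / 4, by positivity, by linarith, fun w hw => ?_⟩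
  have hpu : p / μ.real {u} ≤ 1 := (div_le_one hu0).2 (min_le_left _ _)
  have hpv : p / μ.real {v} ≤ 1 := (div_le_one hv0).2 (min_le_right _ _)
  -- The weight `α` carves out of `μ` mass exactly `p` at each of `u` and `v`. That part contributes
  -- `p(w^u + w^v)`, where cancellation occurs, and the rest at most `1 - 2p`.
  set α : ℕ → ℝ := fun n => ({u} : Set ℕ).indicator (fun _ => p / μ.real {u}) n
    + ({v} : Set ℕ).indicator (fun _ => p / μ.real {v}) n with hα
  have hα01 : ∀ n, 0 ≤ α n ∧ α n ≤ 1 := by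
    intro n
    by_cases h1 : n = u
    · have h2 : n ≠ v := h1 ▸ huv
      simp only [hα, Set.indicator, Set.mem_singleton_iff, h1, if_true, huv, if_false, add_zero]
      exact ⟨by positivity, hpu⟩
    · by_cases h2 : n = v
      · simp only [hα, Set.indicator, Set.mem_singleton_iff, h2, huv.symm, if_true, if_false,
          zero_add]
        exact ⟨by positivity, hpv⟩
      · simp [hα, Set.indicator, h1, h2]
  have hαint : Integrable α μ :=
    ((integrable_const _).indicator (measurableSet_singleton u)).add
      ((integrable_const _).indicator (measurableSet_singleton v))
  have hαmean : ∫ n, α n ∂μ = 2 * p := by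
    rw [hα, integral_add ((integrable_const _).indicator (measurableSet_singleton u))
      ((integrable_const _).indicator (measurableSet_singleton v)),
      integral_indicator_const _ (measurableSet_singleton u),
      integral_indicator_const _ (measurableSet_singleton v)]
    simp only [smul_eq_mul]
    field_simp
    ring
  have hpow : Integrable (fun n : ℕ => w ^ n) μ :=
    Integrable.of_bound (measurable_of_countable _).aestronglyMeasurable 1
      (ae_of_all _ fun n => by rw [norm_pow, hw, one_pow])
  have hmain : Integrable (fun n => (α n : ℂ) * w ^ n) μ :=
    hpow.bdd_mul (c := 1) hαint.ofReal.aestronglyMeasurable (ae_of_all _ fun n => by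
      rw [Complex.norm_real, Real.norm_of_nonneg (hα01 n).1]
      exact (hα01 n).2)
  have hmean : ∫ n, (α n : ℂ) * w ^ n ∂μ = p * (w ^ u + w ^ v) := by
    have h1 : (fun n => (α n : ℂ) * w ^ n)
        = fun n => ({u} : Set ℕ).indicator (fun _ => (p / μ.real {u} : ℂ) * w ^ u) n
          + ({v} : Set ℕ).indicator (fun _ => (p / μ.real {v} : ℂ) * w ^ v) n := by
      ext n
      by_cases h1 : n = u
      · simp [hα, Set.indicator, h1, huv]
      · by_cases h2 : n = v
        · simp [hα, Set.indicator, h2, huv.symm]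
        · simp [hα, Set.indicator, h1, h2]
    rw [h1, integral_add ((integrable_const _).indicator (measurableSet_singleton u))
      ((integrable_const _).indicator (measurableSet_singleton v)),
      integral_indicator_const _ (measurableSet_singleton u),
      integral_indicator_const _ (measurableSet_singleton v)]
    have hu0' : (μ.real {u} : ℂ) ≠ 0 := by exact_mod_cast hu0.ne'
    have hv0' : (μ.real {v} : ℂ) ≠ 0 := by exact_mod_cast hv0.ne'
    simp only [Complex.real_smul]
    field_simp
  have hrest : ‖∫ n, (w ^ n - (α n : ℂ) * w ^ n) ∂μ‖ ≤ 1 - 2 * p := by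
    calc _ ≤ ∫ n, (1 - α n) ∂μ := by
          refine norm_integral_le_of_norm_le ((integrable_const (1 : ℝ)).sub hαint)
            (ae_of_all _ fun n => ?_)
          have : w ^ n - (α n : ℂ) * w ^ n = ((1 - α n : ℝ) : ℂ) * w ^ n := by push_cast; ring
          rw [this, norm_mul, norm_pow, hw, one_pow, mul_one, Complex.norm_real,
            Real.norm_of_nonneg (by linarith [(hα01 n).2])]
      _ = _ := by rw [integral_sub (integrable_const _) hαint, hαmean]; simp
  rw [integral_sub hpow hmain, hmean] at hrest
  have h1 : ‖w ^ u + w ^ v‖ ≤ 2 - ‖w ^ u - w ^ v‖ ^ 2 / 4 :=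
    norm_add_le_of_norm_eq_one (by rw [norm_pow, hw, one_pow]) (by rw [norm_pow, hw, one_pow])
  have h2 : ‖(p : ℂ) * (w ^ u + w ^ v)‖ ≤ p * (2 - ‖w ^ u - w ^ v‖ ^ 2 / 4) := by
    rw [norm_mul, Complex.norm_real, Real.norm_of_nonneg hp0.le]
    gcongr
  have h3 := norm_le_norm_add_norm_sub' (powMean μ w) ((p : ℂ) * (w ^ u + w ^ v))
  unfold powMean at h3 ⊢
  linarith

theorem norm_pow_sub_pow_of_lt {w : ℂ} (hw : ‖w‖ = 1) {u v : ℕ} (huv : u < v) :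
    ‖w ^ u - w ^ v‖ = ‖w ^ (v - u) - 1‖ := by
  have : w ^ u - w ^ v = -(w ^ u * (w ^ (v - u) - 1)) := by
    rw [mul_sub, ← pow_add, Nat.add_sub_cancel' huv.le]; ring
  rw [this, norm_neg, norm_mul, norm_pow, hw, one_pow, one_mul]

variable {p : ℝ} {d : ℕ}

/-- The points `z^(sd)` and `z^((s+1)d)` are `|z^d - 1|` apart, so at least one is at distance `δ/2`
or more from 1. -/
theorem norm_powMean_mul_norm_powMean_le
    (hp : 0 < p) (h : ∀ w : ℂ, ‖w‖ = 1 → ‖powMean μ w‖ ≤ 1 - p * ‖w ^ d - 1‖ ^ 2)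
    {z : ℂ} (hz : ‖z‖ = 1) {δ : ℝ} (hδ : 0 ≤ δ) (hzδ : δ ≤ ‖z ^ d - 1‖) (s : ℕ) :
    ‖powMean μ (z ^ s)‖ * ‖powMean μ (z ^ (s + 1))‖ ≤ 1 - p * (δ / 2) ^ 2 := by
  have n1 : ‖z ^ s‖ = 1 := by rw [norm_pow, hz, one_pow]
  have n2 : ‖z ^ (s + 1)‖ = 1 := by rw [norm_pow, hz, one_pow]
  have hdiff : ‖z ^ d - 1‖ ≤ ‖(z ^ (s + 1)) ^ d - 1‖ + ‖(z ^ s) ^ d - 1‖ := by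
    have h1 : (z ^ (s + 1)) ^ d - (z ^ s) ^ d = z ^ (s * d) * (z ^ d - 1) := by ring
    have h2 : ‖z ^ d - 1‖ = ‖(z ^ (s + 1)) ^ d - (z ^ s) ^ d‖ := by
      rw [h1, norm_mul, norm_pow, hz, one_pow, one_mul]
    rw [h2, show (z ^ (s + 1)) ^ d - (z ^ s) ^ d
      = ((z ^ (s + 1)) ^ d - 1) - ((z ^ s) ^ d - 1) by ring]
    exact norm_sub_le _ _
  have key : ∀ w : ℂ, ‖w‖ = 1 → δ / 2 ≤ ‖w ^ d - 1‖ → ‖powMean μ w‖ ≤ 1 - p * (δ / 2) ^ 2 := by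
    intro w hw hwδ
    refine (h w hw).trans ?_
    gcongr
  rcases le_total (δ / 2) ‖(z ^ s) ^ d - 1‖ with h1 | h1
  · exact (mul_le_of_le_one_right (norm_nonneg _) (norm_powMean_le_one μ n2)).trans (key _ n1 h1)
  · exact (mul_le_of_le_one_left (norm_nonneg _) (norm_powMean_le_one μ n1)).trans
      (key _ n2 (by linarith))

theorem prod_norm_powMean_le
    (hp : 0 < p) (h : ∀ w : ℂ, ‖w‖ = 1 → ‖powMean μ w‖ ≤ 1 - p * ‖w ^ d - 1‖ ^ 2)
    {z : ℂ} (hz : ‖z‖ = 1) {δ : ℝ} (hδ : 0 ≤ δ) (hzδ : δ ≤ ‖z ^ d - 1‖) (L : ℕ) :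
    ∏ s ∈ Finset.range (2 * L), ‖powMean μ (z ^ (s + 1))‖ ≤ (1 - p * (δ / 2) ^ 2) ^ L := by
  induction L with
  | zero => simp
  | succ L ih =>
    rw [show 2 * (L + 1) = 2 * L + 1 + 1 by ring, Finset.prod_range_succ, Finset.prod_range_succ,
      mul_assoc, pow_succ]
    have h1 := norm_powMean_mul_norm_powMean_le μ hp h hz hδ hzδ (2 * L + 1)
    exact mul_le_mul ih h1 (by positivity) (by
      refine le_trans ?_ ih
      positivity)

end PowMean

/-! ### Double sums of consecutive terms -/

/-- The sum of `x (1 + i + j)` over `i < h` and `j < h'`. -/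
def doubleSum (h h' : ℕ) (x : ℕ → ℕ) : ℕ :=
  ∑ i ∈ Finset.range h, ∑ j ∈ Finset.range h', x (1 + (i + j))

/-- The number of representations of `s` as `i + j` with `i < h` and `j < h'`. -/
def reprCount (h h' s : ℕ) : ℕ :=
  ((Finset.range h ×ˢ Finset.range h').filter fun q => q.1 + q.2 = s).card

theorem doubleSum_eq_sum_reprCount (h h' : ℕ) (x : ℕ → ℕ) :
    doubleSum h h' x = ∑ s ∈ Finset.range (h + h'), reprCount h h' s * x (1 + s) := by
  rw [doubleSum, ← Finset.sum_product',
    ← Finset.sum_fiberwise_of_maps_to (t := Finset.range (h + h')) (g := fun q => q.1 + q.2)]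
  · refine Finset.sum_congr rfl fun s _ => ?_
    rw [reprCount, ← smul_eq_mul, ← Finset.sum_const]
    refine Finset.sum_congr rfl fun q hq => ?_
    rw [(Finset.mem_filter.1 hq).2]
  · intro q hq
    simp only [Finset.mem_product, Finset.mem_range] at hq ⊢
    omega

theorem reprCount_eq_succ {h h' s : ℕ} (hs : s < h) (hs' : s < h') : reprCount h h' s = s + 1 := by
  have : (Finset.range h ×ˢ Finset.range h').filter (fun q => q.1 + q.2 = s)
      = Finset.HasAntidiagonal.antidiagonal s := by
    ext q
    simp only [Finset.mem_filter, Finset.mem_product, Finset.mem_range,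
      Finset.HasAntidiagonal.mem_antidiagonal]
    omega
  rw [reprCount, this, Finset.Nat.card_antidiagonal]

theorem reprCount_eq_left {k h s : ℕ} (hs : k ≤ s) (hs' : s < h) : reprCount k h s = k := by
  have : (Finset.range k ×ˢ Finset.range h).filter (fun q => q.1 + q.2 = s)
      = (Finset.range k).image fun i => (i, s - i) := by
    ext ⟨i, j⟩
    simp only [Finset.mem_filter, Finset.mem_product, Finset.mem_range, Finset.mem_image,
      Prod.mk.injEq]
    constructor
    · rintro ⟨⟨h1, h2⟩, h3⟩
      exact ⟨i, h1, rfl, by omega⟩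
    · rintro ⟨a, h1, rfl, rfl⟩
      omega
  rw [reprCount, this, Finset.card_image_of_injective _ fun a b hab => (Prod.mk.inj hab).1,
    Finset.card_range]

theorem dependsOn_doubleSum (h h' : ℕ) :
    DependsOn (doubleSum h h') (Finset.range (h + h' + 1) : Set ℕ) := by
  intro x y hxy
  refine Finset.sum_congr rfl fun i hi => Finset.sum_congr rfl fun j hj => hxy _ ?_
  simp only [Finset.mem_range, Finset.coe_range, Set.mem_Iio] at hi hj ⊢
  omega

section Mean

variable (μ : Measure ℕ) [IsProbabilityMeasure μ]

/-- Grouping the double sum by `s = i + j` makes it a linear combination of independent coordinates,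
so its mean power factorises. -/
theorem integral_pow_blockLaw_doubleSum (h h' : ℕ) (z : ℂ) :
    ∫ a, z ^ a ∂(blockLaw μ (doubleSum h h'))
      = ∏ s ∈ Finset.range (h + h'), powMean μ (z ^ reprCount h h' s) := by
  rw [blockLaw, integral_map (dependsOn_doubleSum h h').measurable_of_finset.aemeasurable
    (measurable_of_countable _).aestronglyMeasurable]
  have h1 : ∀ x : ℕ → ℕ, z ^ doubleSum h h' x
      = ∏ s : Fin (h + h'), (z ^ reprCount h h' s) ^ x (1 + s) := by
    intro x
    rw [doubleSum_eq_sum_reprCount, ← Finset.prod_pow_eq_pow_sum, Finset.prod_range]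
    exact Finset.prod_congr rfl fun s _ => pow_mul _ _ _
  simp_rw [h1]
  have hinj : Function.Injective fun s : Fin (h + h') => 1 + (s : ℕ) :=
    fun a b hab => Fin.ext (Nat.add_left_cancel hab)
  have hind : iIndepFun (fun (s : Fin (h + h')) (x : ℕ → ℕ) => x (1 + (s : ℕ)))
      (Measure.infinitePi fun _ : ℕ => μ) := (iIndepFun_eval_infinitePi μ).precomp hinj
  have h2 := hind.integral_fun_prod_comp
    (f := fun (s : Fin (h + h')) n => (z ^ reprCount h h' s) ^ n)
    (fun s => (measurable_pi_apply _).aemeasurable)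
    (fun s => (measurable_of_countable _).aestronglyMeasurable)
  rw [h2, Finset.prod_range]
  refine Finset.prod_congr rfl fun s _ => ?_
  have h3 : (Measure.infinitePi fun _ : ℕ => μ).map (fun x => x (1 + (s : ℕ))) = μ :=
    Measure.infinitePi_map_eval (fun _ : ℕ => μ) _
  conv_rhs => rw [powMean, ← h3]
  rw [integral_map (measurable_pi_apply _).aemeasurable
    (measurable_of_countable _).aestronglyMeasurable]

theorem norm_integral_pow_blockLaw_doubleSum_le {h h' : ℕ} {z : ℂ} (hz : ‖z‖ = 1) {s : Finset ℕ}
    (hs : s ⊆ Finset.range (h + h')) :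
    ‖∫ a, z ^ a ∂(blockLaw μ (doubleSum h h'))‖
      ≤ ∏ i ∈ s, ‖powMean μ (z ^ reprCount h h' i)‖ := by
  rw [integral_pow_blockLaw_doubleSum, norm_prod]
  exact Finset.prod_le_prod_of_subset_of_le_one hs (fun _ _ => norm_nonneg _)
    fun i _ _ => norm_powMean_le_one μ (by rw [norm_pow, hz, one_pow])

/-- Only the rising edge of the multiplicities is kept, where they run through `1, 2, …, q`. -/
theorem norm_integral_pow_blockLaw_le_of_le {h h' q : ℕ} (hq : q ≤ h) (hq' : q ≤ h') {z : ℂ}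
    (hz : ‖z‖ = 1) :
    ‖∫ a, z ^ a ∂(blockLaw μ (doubleSum h h'))‖
      ≤ ∏ s ∈ Finset.range q, ‖powMean μ (z ^ (s + 1))‖ := by
  refine (norm_integral_pow_blockLaw_doubleSum_le μ hz (s := Finset.range q) ?_).trans_eq ?_
  · exact Finset.range_subset_range.2 (by omega)
  · refine Finset.prod_congr rfl fun s hs => ?_
    rw [Finset.mem_range] at hs
    rw [reprCount_eq_succ (by omega) (by omega)]

/-- Only the plateau `k ≤ s < h` is kept, where every multiplicity equals `k`. -/
theorem norm_integral_pow_blockLaw_le_pow (k h : ℕ) {z : ℂ} (hz : ‖z‖ = 1) :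
    ‖∫ a, z ^ a ∂(blockLaw μ (doubleSum k h))‖ ≤ ‖powMean μ (z ^ k)‖ ^ (h - k) := by
  refine (norm_integral_pow_blockLaw_doubleSum_le μ hz (s := Finset.Ico k h) ?_).trans_eq ?_
  · intro i hi
    rw [Finset.mem_Ico] at hi
    rw [Finset.mem_range]
    omega
  · rw [← Nat.card_Ico, ← Finset.prod_const]
    refine Finset.prod_congr rfl fun s hs => ?_
    rw [Finset.mem_Ico] at hs
    rw [reprCount_eq_left hs.1 hs.2]

end Mean

/-! ### Differences of the partial sums -/

/-- The sum of the first `n` terms of `x`. -/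
def prefixSum (x : ℕ → ℕ) (n : ℕ) : ℕ := ∑ i ∈ Finset.range n, x i

theorem prefixSum_add (x : ℕ → ℕ) (n h : ℕ) :
    prefixSum x (n + h) = prefixSum x n + ∑ l ∈ Finset.range h, x (n + l) :=
  Finset.sum_range_add x n h

theorem partialSums_prefixSum_shift (x : ℕ → ℕ) (k h i : ℕ) :
    partialSums (prefixSum x) k (i + h + 1)
      = partialSums (prefixSum x) k (i + 1) + doubleSum k h (shiftSeq i x) := by
  unfold partialSums doubleSum shiftSeq
  rw [← Finset.sum_add_distrib]
  refine Finset.sum_congr rfl fun j _ => ?_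
  rw [show i + h + 1 + j = i + 1 + j + h by ring, prefixSum_add]
  congr 1
  exact Finset.sum_congr rfl fun l _ => by congr 1; ring

theorem sum_range_shift_add (x : ℕ → ℕ) (k h n : ℕ) :
    ∑ j ∈ Finset.range k, x (n + h + j) + ∑ j ∈ Finset.range h, x (n + j)
      = ∑ j ∈ Finset.range k, x (n + j) + ∑ j ∈ Finset.range h, x (n + k + j) := by
  have h1 := prefixSum_add x n h
  have h2 := prefixSum_add x (n + h) k
  have h3 := prefixSum_add x n k
  have h4 := prefixSum_add x (n + k) h
  have h5 : prefixSum x (n + h + k) = prefixSum x (n + k + h) := by rw [add_right_comm]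
  omega

/-- With `S` the shift, summing over `k` terms and differencing at lag `h'` gives `(S^k - 1)(S^h' -
1)/(S - 1)`, which is symmetric in `k` and `h'`. This trades the unbounded length `k` for a mere
distance. The additive form avoids subtraction in `ℕ`. -/
theorem doubleSum_shift (x : ℕ → ℕ) (k h h' i : ℕ) :
    doubleSum k h (shiftSeq (i + h') x) + doubleSum h h' (shiftSeq i x)
      = doubleSum k h (shiftSeq i x) + doubleSum h h' (shiftSeq (i + k) x) := by
  have h1 : ∀ r, doubleSum k h (shiftSeq r x)
      = ∑ l ∈ Finset.range h, ∑ j ∈ Finset.range k, x (r + 1 + l + j) := by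
    intro r
    rw [doubleSum, Finset.sum_comm]
    exact Finset.sum_congr rfl fun l _ => Finset.sum_congr rfl fun j _ => by
      unfold shiftSeq; congr 1; ring
  have h2 : ∀ r, doubleSum h h' (shiftSeq r x)
      = ∑ l ∈ Finset.range h, ∑ j ∈ Finset.range h', x (r + 1 + l + j) := by
    intro r
    exact Finset.sum_congr rfl fun l _ => Finset.sum_congr rfl fun j _ => by
      unfold shiftSeq; congr 1; ring
  rw [h1, h1, h2, h2, ← Finset.sum_add_distrib, ← Finset.sum_add_distrib]
  refine Finset.sum_congr rfl fun l _ => ?_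
  have := sum_range_shift_add x k h' (i + 1 + l)
  rw [show i + 1 + l + h' = i + h' + 1 + l by ring,
    show i + 1 + l + k = i + k + 1 + l by ring] at this
  exact this

theorem pow_mul_conj_pow_eq {z : ℂ} (hz : ‖z‖ = 1) {a b a' b' : ℕ} (h : a + b = a' + b') :
    z ^ a * conj (z ^ a') = z ^ b' * conj (z ^ b) := by
  have hz0 : z ≠ 0 := norm_ne_zero_iff.1 (by rw [hz]; exact one_ne_zero)
  rw [map_pow, map_pow, ← Complex.inv_eq_conj hz, inv_pow, inv_pow, ← div_eq_mul_inv,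
    ← div_eq_mul_inv, div_eq_div_iff (pow_ne_zero _ hz0) (pow_ne_zero _ hz0), ← pow_add, ← pow_add,
    h, add_comm]

/-! ### Exponential averages along typical sequences -/

/-- The empirical distributions of all double sums along `x`, and of pairs of them at distant
times, are uniformly close to the corresponding laws. -/
structure IsTypical (μ : Measure ℕ) (x : ℕ → ℕ) : Prop where
  single : ∀ h h' : ℕ, ∀ ε : ℝ, 0 < ε → ∀ᶠ N : ℕ in atTop, ∀ F : ℕ → ℂ, (∀ a, ‖F a‖ ≤ 1) →
    ‖∑ n ∈ Finset.range N, F (doubleSum h h' (shiftSeq n x))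
      - N * ∫ a, F a ∂(blockLaw μ (doubleSum h h'))‖ ≤ ε * N
  pair : ∀ h h' : ℕ, ∀ ε : ℝ, 0 < ε → ∀ᶠ N : ℕ in atTop, ∀ k, h + h' + 1 ≤ k → k ≤ N →
    ∀ F : ℕ × ℕ → ℂ, (∀ a, ‖F a‖ ≤ 1) →
      ‖∑ n ∈ Finset.range N,
          F (doubleSum h h' (shiftSeq (n + k) x), doubleSum h h' (shiftSeq n x))
        - N * ∫ a, F a ∂((blockLaw μ (doubleSum h h')).prod (blockLaw μ (doubleSum h h')))‖
        ≤ ε * N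

section Typical

variable (μ : Measure ℕ) [IsProbabilityMeasure μ]

theorem ae_isTypical : ∀ᵐ x ∂(Measure.infinitePi fun _ : ℕ => μ), IsTypical μ x := by
  have h1 := ae_all_iff.2 fun h : ℕ => ae_all_iff.2 fun h' : ℕ =>
    ae_eventually_empirical_close μ (dependsOn_doubleSum h h') (Nat.succ_pos _)
  have h2 := ae_all_iff.2 fun h : ℕ => ae_all_iff.2 fun h' : ℕ =>
    ae_eventually_empirical_pair_close μ (dependsOn_doubleSum h h') (Nat.succ_pos _)
  filter_upwards [h1, h2] with x hx1 hx2
  exact ⟨hx1, hx2⟩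

variable {μ} {x : ℕ → ℕ}

theorem norm_le_of_norm_sub_natCast_mul_le {S E : ℂ} {N : ℕ} {ε η : ℝ}
    (h : ‖S - N * E‖ ≤ ε * N) (hE : ‖E‖ ≤ η) : ‖S‖ ≤ (η + ε) * N := by
  have h1 := norm_le_norm_add_norm_sub' S (N * E)
  have h2 : ‖(N : ℂ) * E‖ ≤ N * η := by
    rw [norm_mul, Complex.norm_natCast]
    gcongr
  linarith

/-- For fixed `k` one van der Corput step suffices: the correlation at lag `h` has mean at most
`|φ(z^k)|^(h-k)`, small for `h ≥ k + L`. The threshold on `N` depends on `k` and `z`. -/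
theorem IsTypical.eventually_norm_sum_pow_le (hx : IsTypical μ x) {k : ℕ} {z : ℂ} (hz : ‖z‖ = 1)
    (hk : ‖powMean μ (z ^ k)‖ < 1) {ε : ℝ} (hε : 0 < ε) :
    ∀ᶠ N : ℕ in atTop,
      ‖∑ i ∈ Finset.range N, z ^ partialSums (prefixSum x) k (i + 1)‖ ^ 2 ≤ 4 * ε * (N : ℝ) ^ 2 := by
  obtain ⟨L, hL⟩ := exists_pow_lt_of_lt_one (half_pos hε) hk
  obtain ⟨H, hH⟩ := exists_van_der_corput hε (k + L)
  filter_upwards [hH, (Finset.eventually_all (Finset.range H)).2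
    fun h _ => hx.single k h (ε / 2) (half_pos hε)] with N hN hN'
  have hone : ∀ e : ℕ, ‖z ^ e‖ ≤ 1 := fun e => by rw [norm_pow, hz, one_pow]
  refine hN (fun i => z ^ partialSums (prefixSum x) k (i + 1)) (fun i => hone _)
    fun h hLh hhH => ?_
  have h1 := hN' h (Finset.mem_range.2 hhH) (fun a => z ^ a) hone
  have h2 : ∀ n, z ^ partialSums (prefixSum x) k (n + h + 1)
      * conj (z ^ partialSums (prefixSum x) k (n + 1)) = z ^ doubleSum k h (shiftSeq n x) := by
    intro n
    rw [pow_mul_conj_pow_eq hz (b := 0) (b' := doubleSum k h (shiftSeq n x))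
      (by rw [add_zero, partialSums_prefixSum_shift])]
    simp
  simp_rw [h2]
  have h3 : ‖∫ a, z ^ a ∂(blockLaw μ (doubleSum k h))‖ ≤ ε / 2 := by
    refine (norm_integral_pow_blockLaw_le_pow μ k h hz).trans (le_trans ?_ hL.le)
    exact pow_le_pow_of_le_one (norm_nonneg _) hk.le (by omega)
  exact (norm_le_of_norm_sub_natCast_mul_le h1 h3).trans_eq (by ring)

theorem norm_integral_prod_pow_mul_conj_pow (ρ : Measure ℕ) [IsProbabilityMeasure ρ] (z : ℂ) :
    ‖∫ a : ℕ × ℕ, z ^ a.1 * conj (z ^ a.2) ∂(ρ.prod ρ)‖ = ‖∫ a, z ^ a ∂ρ‖ ^ 2 := by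
  have h := integral_prod_mul (μ := ρ) (ν := ρ) (fun a : ℕ => z ^ a) (fun b : ℕ => conj (z ^ b))
  rw [h, integral_conj, norm_mul, RCLike.norm_conj, sq]

/-- The inner van der Corput step bounds the correlations required by the outer one. All thresholds
are chosen before `k` and `z`, giving the uniformity that the supremum over `k` needs. -/
theorem IsTypical.exists_eventually_norm_sum_pow_le (hx : IsTypical μ x) {p : ℝ} {d : ℕ}
    (hp : 0 < p) (hp1 : p ≤ 1)
    (h : ∀ w : ℂ, ‖w‖ = 1 → ‖powMean μ w‖ ≤ 1 - p * ‖w ^ d - 1‖ ^ 2)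
    {δ : ℝ} (hδ : 0 < δ) (hδ1 : δ ≤ 1) {ε : ℝ} (hε : 0 < ε) :
    ∃ m : ℕ, ∀ᶠ N : ℕ in atTop, ∀ k, m ≤ k → k ≤ N → ∀ z : ℂ, ‖z‖ = 1 → δ ≤ ‖z ^ d - 1‖ →
      ‖∑ i ∈ Finset.range N, z ^ partialSums (prefixSum x) k (i + 1)‖ ^ 2
        ≤ 4 * ε * (N : ℝ) ^ 2 := by
  -- With this value the inner conclusion `4ε'N²` is exactly `(εN)²`, the square of what the outer
  -- step requires.
  set ε' := ε ^ 2 / 4 with hε'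
  have hε'0 : 0 < ε' := by positivity
  have hq0 : 0 ≤ 1 - p * (δ / 2) ^ 2 := by nlinarith
  have hq1 : 1 - p * (δ / 2) ^ 2 < 1 := sub_lt_self _ (by positivity)
  obtain ⟨L, hL⟩ := exists_pow_lt_of_lt_one (half_pos hε'0) hq1
  obtain ⟨H, hH⟩ := exists_van_der_corput hε (2 * L)
  obtain ⟨H', hH'⟩ := exists_van_der_corput hε'0 (2 * L)
  -- For lags `j < H` and `j' < H'` this keeps `k` at least the block length `j + j' + 1`, as the
  -- pair estimate demands.
  refine ⟨H + H' + 1, ?_⟩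
  filter_upwards [hH, hH', (Finset.eventually_all (Finset.range H)).2 fun j _ =>
    (Finset.eventually_all (Finset.range H')).2 fun j' _ => hx.pair j j' (ε' / 2) (half_pos hε'0)]
    with N hN hN' hpair k hmk hkN z hz hzδ
  have hone : ∀ e : ℕ, ‖z ^ e‖ ≤ 1 := fun e => by rw [norm_pow, hz, one_pow]
  refine hN (fun i => z ^ partialSums (prefixSum x) k (i + 1)) (fun i => hone _)
    fun j hLj hjH => ?_
  have h1 : ∀ n, z ^ partialSums (prefixSum x) k (n + j + 1)
      * conj (z ^ partialSums (prefixSum x) k (n + 1)) = z ^ doubleSum k j (shiftSeq n x) := by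
    intro n
    rw [pow_mul_conj_pow_eq hz (b := 0) (b' := doubleSum k j (shiftSeq n x))
      (by rw [add_zero, partialSums_prefixSum_shift])]
    simp
  simp_rw [h1]
  have h2 := hN' (fun n => z ^ doubleSum k j (shiftSeq n x)) (fun n => hone _)
    fun j' hLj' hjH' => by
      have := isProbabilityMeasure_blockLaw μ (dependsOn_doubleSum j j').measurable_of_finset
      have h3 := hpair j (Finset.mem_range.2 hjH) j' (Finset.mem_range.2 hjH') k (by omega) hkN
        (fun a => z ^ a.1 * conj (z ^ a.2)) fun a => norm_mul_conj_le (hone _) (hone _)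
      have h4 : ∀ n, z ^ doubleSum k j (shiftSeq (n + j') x)
          * conj (z ^ doubleSum k j (shiftSeq n x))
          = z ^ doubleSum j j' (shiftSeq (n + k) x) * conj (z ^ doubleSum j j' (shiftSeq n x)) :=
        fun n => pow_mul_conj_pow_eq hz (doubleSum_shift x k j j' n)
      simp_rw [h4]
      have h5 : ‖∫ a, z ^ a ∂(blockLaw μ (doubleSum j j'))‖ ≤ ε' / 2 :=
        (norm_integral_pow_blockLaw_le_of_le μ hLj hLj' hz).trans
          ((prod_norm_powMean_le μ hp h hz hδ.le hzδ L).trans hL.le)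
      have h6 : ‖∫ a, z ^ a ∂(blockLaw μ (doubleSum j j'))‖ ≤ 1 := by
        have := norm_integral_le_of_norm_le_const (μ := blockLaw μ (doubleSum j j'))
          (f := fun a : ℕ => z ^ a) (C := 1) (ae_of_all _ hone)
        simpa using this
      have h7 : ‖∫ a : ℕ × ℕ, z ^ a.1 * conj (z ^ a.2)
          ∂((blockLaw μ (doubleSum j j')).prod (blockLaw μ (doubleSum j j')))‖ ≤ ε' / 2 := by
        rw [norm_integral_prod_pow_mul_conj_pow]
        nlinarith [norm_nonneg (∫ a, z ^ a ∂(blockLaw μ (doubleSum j j')))]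
      exact (norm_le_of_norm_sub_natCast_mul_le h3 h7).trans_eq (by ring)
  refine abs_le_of_sq_le_sq' ?_ (by positivity) |>.2
  refine h2.trans_eq ?_
  rw [hε']
  ring

end Typical

/-! ### Mean squares along typical sequences -/

theorem sum_Icc_one_eq_sum_range {M : Type*} [AddCommMonoid M] (f : ℕ → M) (N : ℕ) :
    ∑ n ∈ Finset.Icc 1 N, f n = ∑ i ∈ Finset.range N, f (i + 1) := by
  rw [Finset.range_eq_Ico, Finset.sum_Ico_add' f 0 N 1, zero_add]
  rfl

theorem sq_norm_average_le {e : ℕ → ℕ} {N : ℕ} (hN : 0 < N) {z : ℂ} {ε : ℝ}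
    (h : ‖∑ i ∈ Finset.range N, z ^ e (i + 1)‖ ^ 2 ≤ ε * (N : ℝ) ^ 2) :
    ‖(1 / (N : ℂ)) * ∑ n ∈ Finset.Icc 1 N, z ^ e n‖ ^ 2 ≤ ε := by
  have hN' : (0 : ℝ) < N := by exact_mod_cast hN
  rw [sum_Icc_one_eq_sum_range (fun n => z ^ e n), norm_mul, norm_div, norm_one,
    Complex.norm_natCast, one_div_mul_eq_div, div_pow, div_le_iff₀ (by positivity)]
  exact h

theorem exists_measureReal_norm_pow_sub_one_lt (σ : Measure Circle) [IsFiniteMeasure σ] {d : ℕ}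
    (h : σ {z : Circle | (z : ℂ) ^ d = 1} = 0) {ε : ℝ} (hε : 0 < ε) :
    ∃ δ : ℝ, 0 < δ ∧ δ ≤ 1 ∧ σ.real {z : Circle | ‖(z : ℂ) ^ d - 1‖ < δ} < ε := by
  set S : ℕ → Set Circle := fun n => {z : Circle | ‖(z : ℂ) ^ d - 1‖ < 1 / ((n : ℝ) + 1)} with hS
  have hmeas : ∀ n, MeasurableSet (S n) := fun n =>
    (isOpen_lt (by fun_prop) continuous_const).measurableSet
  have hanti : Antitone S := fun m n hmn z hz =>
    lt_of_lt_of_le (show ‖(z : ℂ) ^ d - 1‖ < 1 / ((n : ℝ) + 1) from hz)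
      (Nat.one_div_le_one_div hmn)
  have hlim := tendsto_measure_iInter_atTop (μ := σ) (fun n => (hmeas n).nullMeasurableSet) hanti
    ⟨0, measure_ne_top _ _⟩
  have hInter : ⋂ n, S n ⊆ {z : Circle | (z : ℂ) ^ d = 1} := by
    intro z hz
    rw [Set.mem_iInter] at hz
    by_contra hne
    have hpos : 0 < ‖(z : ℂ) ^ d - 1‖ := norm_pos_iff.2 (sub_ne_zero.2 hne)
    obtain ⟨n, hn⟩ := exists_nat_one_div_lt hpos
    exact lt_asymm hn (hz n)
  rw [measure_mono_null hInter h] at hlim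
  have hlim' := (ENNReal.tendsto_toReal ENNReal.zero_ne_top).comp hlim
  obtain ⟨n, hn⟩ := (hlim'.eventually_lt_const (by simpa using hε)).exists
  exact ⟨1 / ((n : ℝ) + 1), Nat.one_div_pos_of_nat,
    by rw [div_le_one (by positivity)]; linarith [(Nat.cast_nonneg n : (0 : ℝ) ≤ n)], hn⟩

theorem meanSquare_le_of_forall_notMem (σ : Measure Circle) [IsProbabilityMeasure σ] {e : ℕ → ℕ}
    {N : ℕ} {B : Set Circle} (hB : MeasurableSet B) {ε : ℝ} (hε : 0 ≤ ε)
    (h : ∀ z : Circle, z ∉ B →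
      ‖(1 / (N : ℂ)) * ∑ n ∈ Finset.Icc 1 N, (z : ℂ) ^ e n‖ ^ 2 ≤ ε) :
    meanSquare σ e N ≤ σ.real B + ε := by
  have hint : Integrable (B.indicator (1 : Circle → ℝ)) σ := (integrable_const (1 : ℝ)).indicator hB
  calc meanSquare σ e N ≤ ∫ z, (B.indicator (1 : Circle → ℝ) z + ε) ∂σ := by
        refine integral_mono (integrable_sq_norm_average σ e N)
          (hint.add (integrable_const ε)) fun z => ?_
        by_cases hz : z ∈ B
        · have := pow_le_one₀ (n := 2) (norm_nonneg _) (norm_average_pow_le_one e N z)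
          simp only [hz, Set.indicator_of_mem, Pi.one_apply]
          linarith
        · simpa [hz] using h z hz
    _ = σ.real B + ε := by
        rw [integral_add hint (integrable_const ε), integral_indicator_one hB]
        simp

theorem tendsto_iSup_of_eventually_le {f : ℕ → ℕ → ℝ} (h0 : ∀ k N, 0 ≤ f k N)
    (h : ∀ ε : ℝ, 0 < ε → ∀ᶠ N : ℕ in atTop, ∀ k, 1 ≤ k → k ≤ N → f k N ≤ ε) :
    Tendsto (fun N : ℕ => ⨆ k : Set.Icc 1 N, f k N) atTop (𝓝 0) := by
  rw [tendsto_order]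
  refine ⟨fun a ha => Eventually.of_forall fun N =>
    lt_of_lt_of_le ha (Real.iSup_nonneg fun k => h0 _ _), fun a ha => ?_⟩
  filter_upwards [h (a / 2) (half_pos ha)] with N hN
  exact lt_of_le_of_lt (Real.iSup_le (fun k => hN k k.2.1 k.2.2) (half_pos ha).le)
    (half_lt_self ha)

theorem IsTypical.tendsto_meanSquare {μ : Measure ℕ} [IsProbabilityMeasure μ] {x : ℕ → ℕ}
    (hx : IsTypical μ x) (σ : Measure Circle) [IsProbabilityMeasure σ] {k : ℕ}
    (h : ∀ᵐ z : Circle ∂σ, ‖powMean μ ((z : ℂ) ^ k)‖ < 1) :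
    Tendsto (fun N => meanSquare σ (partialSums (prefixSum x) k) N) atTop (𝓝 0) := by
  have h0 : (0 : ℝ) = ∫ _ : Circle, (0 : ℝ) ∂σ := by simp
  rw [h0]
  refine tendsto_integral_of_dominated_convergence (fun _ => 1)
    (fun N => (integrable_sq_norm_average σ _ N).aestronglyMeasurable) (integrable_const _)
    (fun N => ae_of_all _ fun z => ?_) ?_
  · rw [Real.norm_of_nonneg (by positivity)]
    exact pow_le_one₀ (norm_nonneg _) (norm_average_pow_le_one _ N z)
  · filter_upwards [h] with z hz
    rw [tendsto_order]
    refine ⟨fun a ha => Eventually.of_forall fun N => lt_of_lt_of_le ha (by positivity),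
      fun a ha => ?_⟩
    filter_upwards [hx.eventually_norm_sum_pow_le (Circle.norm_coe z) hz
      (show 0 < a / 8 by positivity), eventually_ge_atTop 1] with N hN hN1
    exact lt_of_le_of_lt (sq_norm_average_le hN1 hN) (by linarith)

theorem IsTypical.tendsto_iSup_meanSquare {μ : Measure ℕ} [IsProbabilityMeasure μ] {x : ℕ → ℕ}
    (hx : IsTypical μ x) {u v : ℕ} (huv : u < v) (hu : μ {u} ≠ 0) (hv : μ {v} ≠ 0)
    (σ : Measure Circle) [IsProbabilityMeasure σ]
    (hσ : ∀ j : ℕ, 0 < j → σ {z : Circle | (z : ℂ) ^ j = 1} = 0) :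
    Tendsto (fun N : ℕ => ⨆ k : Set.Icc 1 N, meanSquare σ (partialSums (prefixSum x) (k : ℕ)) N)
      atTop (𝓝 0) := by
  obtain ⟨p, hp, hp1, hbound⟩ := exists_norm_powMean_le μ huv.ne hu hv
  set d := v - u with hd
  have hd0 : 0 < d := Nat.sub_pos_of_lt huv
  have hφ : ∀ w : ℂ, ‖w‖ = 1 → ‖powMean μ w‖ ≤ 1 - p * ‖w ^ d - 1‖ ^ 2 := fun w hw => by
    rw [hd, ← norm_pow_sub_pow_of_lt hw huv]
    exact hbound w hw
  refine tendsto_iSup_of_eventually_le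
    (f := fun k N => meanSquare σ (partialSums (prefixSum x) k) N)
    (fun k N => meanSquare_nonneg _ _ _) fun ε hε => ?_
  obtain ⟨δ, hδ, hδ1, hσδ⟩ :=
    exists_measureReal_norm_pow_sub_one_lt σ (hσ d hd0) (half_pos hε)
  obtain ⟨m, hm⟩ := hx.exists_eventually_norm_sum_pow_le hp hp1 hφ hδ hδ1
    (show 0 < ε / 8 by positivity)
  -- Finitely many `k` remain, so no uniformity is needed: `|φ(z^k)| < 1` off the `kd`-th roots of
  -- unity, a null set.
  have hsmall : ∀ k ∈ Finset.Ico 1 m, ∀ᶠ N : ℕ in atTop,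
      meanSquare σ (partialSums (prefixSum x) k) N ≤ ε := by
    intro k hk
    rw [Finset.mem_Ico] at hk
    have hae : ∀ᵐ z : Circle ∂σ, ‖powMean μ ((z : ℂ) ^ k)‖ < 1 := by
      have h1 : ∀ᵐ z : Circle ∂σ, ¬ (z : ℂ) ^ (k * d) = 1 := by
        rw [ae_iff]
        simpa using hσ (k * d) (Nat.mul_pos hk.1 hd0)
      filter_upwards [h1] with z hz
      refine lt_of_le_of_lt (hφ _ (by rw [norm_pow, Circle.norm_coe, one_pow]))
        (sub_lt_self _ ?_)
      rw [← pow_mul]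
      have : 0 < ‖(z : ℂ) ^ (k * d) - 1‖ := norm_pos_iff.2 (sub_ne_zero.2 hz)
      positivity
    filter_upwards [(hx.tendsto_meanSquare σ hae).eventually_lt_const hε] with N hN
    exact hN.le
  filter_upwards [hm, (Finset.eventually_all _).2 hsmall, eventually_ge_atTop 1]
    with N hN hN' hN1 k hk1 hkN
  rcases lt_or_ge k m with hkm | hmk
  · exact hN' k (Finset.mem_Ico.2 ⟨hk1, hkm⟩)
  · refine (meanSquare_le_of_forall_notMem σ (B := {z : Circle | ‖(z : ℂ) ^ d - 1‖ < δ})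
      (isOpen_lt (by fun_prop) continuous_const).measurableSet (half_pos hε).le
      fun z hz => ?_).trans (by linarith)
    refine sq_norm_average_le hN1 ?_
    refine (hN k hmk hkN z (Circle.norm_coe z) (not_lt.1 hz)).trans_eq ?_
    ring

/-! ### Constant sequences and the main theorem -/

/-- The part of the exponent independent of `n` is a common unimodular factor. -/
theorem meanSquare_partialSums_const (σ : Measure Circle) (c k N : ℕ) :
    meanSquare σ (partialSums (prefixSum fun _ => c) k) N
      = meanSquare σ (fun n => n * (c * k)) N := by
  unfold meanSquare
  congr 1
  ext z
  have h1 : ∀ n, partialSums (prefixSum fun _ => c) k n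
      = c * (∑ j ∈ Finset.range k, j) + n * (c * k) := by
    intro n
    simp only [partialSums, prefixSum, Finset.sum_const, Finset.card_range, smul_eq_mul, add_mul,
      Finset.sum_add_distrib, ← Finset.sum_mul]
    ring
  simp_rw [h1, pow_add, ← Finset.mul_sum]
  rw [mul_left_comm, norm_mul ((z : ℂ) ^ _), norm_pow, Circle.norm_coe, one_pow, one_mul]

theorem universallyWeaklyPowerErgodic_const {c : ℕ} (hc : 0 < c) :
    UniversallyWeaklyPowerErgodic.{u} (prefixSum fun _ => c) := by
  intro X _ μ _ T _ hT σ hσ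
  have : IsProbabilityMeasure σ := by
    obtain ⟨_, _, _, _, h⟩ := hσ
    exact h.isProbabilityMeasure
  simp_rw [meanSquare_partialSums_const]
  exact tendsto_iSup_meanSquare_mul σ (hT σ hσ) hc

theorem IsTypical.universallyWeaklyPowerErgodic {μ : Measure ℕ} [IsProbabilityMeasure μ]
    {x : ℕ → ℕ} (hx : IsTypical μ x) {u v : ℕ} (huv : u < v) (hu : μ {u} ≠ 0) (hv : μ {v} ≠ 0) :
    UniversallyWeaklyPowerErgodic.{u} (prefixSum x) := by
  intro X _ P _ T _ hT σ hσ
  have : IsProbabilityMeasure σ := by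
    obtain ⟨_, _, _, _, h⟩ := hσ
    exact h.isProbabilityMeasure
  exact hx.tendsto_iSup_meanSquare huv hu hv σ fun j hj =>
    measure_setOf_pow_eq_one σ (hT σ hσ) hj

theorem ae_eq_const_of_forall_atom_eq {μ : Measure ℕ} {c : ℕ} (h : ∀ n, μ {n} ≠ 0 → n = c) :
    ∀ᵐ n ∂μ, n = c := by
  rw [ae_iff]
  have : {n | ¬ n = c} = ⋃ n ∈ {n | ¬ n = c}, {n} := by ext n; simp
  rw [this, measure_biUnion_null_iff (Set.to_countable _)]
  intro n hn
  by_contra hne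
  exact hn (h n hne)

theorem ae_universallyWeaklyPowerErgodic (μ : Measure ℕ) [IsProbabilityMeasure μ]
    (h0 : μ {0} = 0) :
    ∀ᵐ x ∂(Measure.infinitePi fun _ : ℕ => μ),
      UniversallyWeaklyPowerErgodic.{u} (prefixSum x) := by
  obtain ⟨c, hc⟩ : ∃ c, μ {c} ≠ 0 := by
    by_contra! hcon
    have h1 : ∀ᵐ n ∂μ, n = 0 := ae_eq_const_of_forall_atom_eq fun n hn => (hn (hcon n)).elim
    have h2 : ∀ᵐ n ∂μ, n ≠ 0 := by
      rw [ae_iff]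
      simpa using h0
    obtain ⟨n, hn, hn'⟩ := (h1.and h2).exists
    exact hn' hn
  by_cases hdeg : ∀ n, μ {n} ≠ 0 → n = c
  · have hc0 : 0 < c := Nat.pos_of_ne_zero fun h => hc (h ▸ h0)
    have h1 : ∀ i : ℕ, ∀ᵐ x ∂(Measure.infinitePi fun _ : ℕ => μ), x i = c := fun i => by
      have h2 := ae_eq_const_of_forall_atom_eq hdeg
      rw [← Measure.infinitePi_map_eval (fun _ : ℕ => μ) i] at h2
      exact ae_of_ae_map (measurable_pi_apply i).aemeasurable h2
    filter_upwards [ae_all_iff.2 h1] with x hx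
    rw [show x = fun _ => c from funext hx]
    exact universallyWeaklyPowerErgodic_const hc0
  · push Not at hdeg
    obtain ⟨v, hv, hvc⟩ := hdeg
    filter_upwards [ae_isTypical μ] with x hx
    rcases lt_or_gt_of_ne hvc with h | h
    · exact hx.universallyWeaklyPowerErgodic h hv hc
    · exact hx.universallyWeaklyPowerErgodic h hc hv

theorem theoremT {Ω₀ : Type v} [MeasurableSpace Ω₀] (P₀ : Measure Ω₀)
    [IsProbabilityMeasure P₀] {Ω : Type w} [MeasurableSpace Ω] (P : Measure Ω)
    [IsProbabilityMeasure P] (β : Ω₀ → ℕ) (hβ_meas : Measurable β) (hβ_pos : ∀ x, 0 < β x)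
    (hβ_mean : Integrable (fun x => (β x : ℝ)) P₀) (b : ℕ → Ω → ℕ)
    (hb : IsIIDCopies P₀ P β b) :
    ∀ᵐ ω ∂P, UniversallyWeaklyPowerErgodic.{u} (stochasticSequence b ω) := by
  have : IsProbabilityMeasure (P₀.map β) := Measure.isProbabilityMeasure_map hβ_meas.aemeasurable
  have h0 : P₀.map β {0} = 0 := by
    rw [Measure.map_apply hβ_meas (measurableSet_singleton 0)]
    have : β ⁻¹' {0} = ∅ := by
      ext x
      simpa using (hβ_pos x).ne'
    rw [this, measure_empty]
  have hlaw : P.map (fun ω i => b i ω) = Measure.infinitePi fun _ : ℕ => P₀.map β := by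
    rw [hb.iIndepFun.map_fun_eq_infinitePi_map hb.measurable]
    congr 1
    exact funext fun i => (hb.identDistrib i).map_eq
  have h := ae_universallyWeaklyPowerErgodic.{u} (P₀.map β) h0
  rw [← hlaw] at h
  -- Pulling back along the sequence map needs no measurability of the set of good sequences, which
  -- is defined by quantifying over all systems.
  exact ae_of_ae_map (measurable_pi_iff.2 hb.measurable).aemeasurable h
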